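/- For a sequence $\boldsymbol X=\{X_n\}_{n\ge1}$ of real random variables on a common probability space let $M_n=\max_{1\le k\le n}X_k$, let $I_1=1$ and $I_n=\mathbf 1(X_n>M_{n-1})$ for $n\ge2$ be the record indicators, and let $N_n=\sum_{k=1}^n I_k$ be the number of records up to time $n$. For a distribution function $G$ put $G^{\leftarrow}(u)=\inf\{x\in\mathbb R: G(x)\ge u\}$, $u\in(0,1)$, and $G^{\leftarrow}(1-)=\lim_{u\uparrow1}G^{\leftarrow}(u)\in(-\infty,\infty]$. Let $F$ be a continuous distribution function, let $\alpha_n>0$ ($n\ge1$) be such that $s_n:=\sum_{k=1}^n\alpha_k\to\infty$, and let $\{\ell_n\}_{n\ge1}$ be a non-decreasing real sequence. Let $\{X_n^\circ\}_{n\ge1}$ be an $F^\alpha$-scheme, that is, a sequence of independent random variables such that $X_n^\circ$ has the distribution function $F^{\alpha_n}$, and let $M_n^\circ$, $I_n^\circ$, $N_n^\circ$ be its partial maxima, record indicators and record counts. Put $p_n=\mathbf P(I_n^\circ=1)$, $E_n=\mathbf E N_n^\circ$ and $V_n=\operatorname{Var}(N_n^\circ)$. Assume that $\boldsymbol X$ is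 a threshold $F^\alpha$-scheme with $F$, $\{\alpha_n\}$ and $\{\ell_n\}$: denoting by $F_n$ the distribution function of $X_n$ and by $F_{n|x_1,\dots,x_{n-1}}$ its conditional distribution function given $X_1=x_1,\dots,X_{n-1}=x_{n-1}$, 1. for every $n\ge 1$, $F_n^{\leftarrow}(1-)\le F^{\leftarrow}(1-)$, and $X_n$ has no atom at the upper end point of $F$: $\mathbf P(X_n=F^{\leftarrow}(1-))=0$; 2. for every $n\ge2$ and almost all $(x_1,\dots,x_{n-1})$ with respect to the law of $(X_1,\dots,X_{n-1})$, $F_{n|x_1,\dots,x_{n-1}}(x)=F_n(x)$ for all $x\ge\ell_n$; 3. $\sum_{n\ge1}\int_{(\ell_n,\infty)}|d(F_n-F^{\alpha_n})|<\infty$; 4. $\mathbf P(M_n^\circ>\ell_n\text{ for all sufficiently large }n)=1$. Then $p_n=\alpha_n/s_n$, $E_n=\sum_{k=1}^np_k$ and $V_n=\sum_{k=1}^np_k(1-p_k)$ for all $n\ge1$, and the following assertions hold as $n\to\infty$: - (A1) $N_n\to\infty$ a.s. - (A2) $N_n/E_n\to1$ a.s. - (A3) $(N_n-E_n)/\ln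 s_n\to0$ a.s. If $p_n\to0$, then $N_n/\ln s_n\to1$ a.s.; if $p_n\to1$, then $N_n/\ln s_n\to0$ a.s. - (A4) If $\lim_n V_n<\infty$, then $N_n-E_n$ converges a.s. to a (finite) random variable; if $\lim_nV_n=\infty$, then $V_n^{-1/2}(N_n-E_n)$ converges in distribution to the standard normal law $N(0,1)$. -/

import Mathlib

open MeasureTheory ProbabilityTheory Filter Topology

namespace RecordScheme

/-! Sequences are indexed from `0`: the terms `x 0, x 1, x 2, …` of a Lean sequence are the terms
`x₁, x₂, x₃, …` of the mathematical one. So `partialSups x n` (Mathlib's running maximum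
`x 0 ⊔ ⋯ ⊔ x n`) is the partial maximum of the first `n + 1` terms. The counting functions
`recordCount x n` and `weightSum α n` refer to the first `n` terms. -/

/-- The upper record indicators of a real sequence: the first term is a record, and a later term is
a record if it strictly exceeds the maximum of all the preceding terms. -/
noncomputable def recordIndicator (x : ℕ → ℝ) : ℕ → ℝ
  | 0 => 1
  | n + 1 => if partialSups x n < x (n + 1) then 1 else 0

/-- The number of records among the first `n` terms of a real sequence. -/
noncomputable def recordCount (x : ℕ → ℝ) (n : ℕ) : ℝ :=
  ∑ k ∈ Finset.range n, recordIndicator x k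

/-- `s_n = α₁ + ⋯ + α_n`, the sum of the first `n` exponents. -/
noncomputable def weightSum (α : ℕ → ℝ) (n : ℕ) : ℝ :=
  ∑ k ∈ Finset.range n, α k

/-- `F` is a continuous distribution function on the real line. -/
structure IsContinuousDF (F : ℝ → ℝ) : Prop where
  monotone : Monotone F
  continuous : Continuous F
  tendsto_atBot : Tendsto F atBot (𝓝 0)
  tendsto_atTop : Tendsto F atTop (𝓝 1)

/-- The generalized inverse `G^←(u) = inf {x ∈ ℝ : G x ≥ u}`, for `u ∈ (0, 1)`. -/
noncomputable def genInv (G : ℝ → ℝ) (u : ℝ) : ℝ :=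
  sInf {x : ℝ | u ≤ G x}

/-- `G^←(1-)`, an element of `(-∞, ∞]`. Since `G^←` is nondecreasing on `(0, 1)`, its left limit at
`1` is its supremum over `(0, 1)`. -/
noncomputable def rightEnd (G : ℝ → ℝ) : EReal :=
  ⨆ u ∈ Set.Ioo (0 : ℝ) 1, (genInv G u : EReal)

section

variable {Ω Ω' : Type*} [MeasurableSpace Ω] [MeasurableSpace Ω']

/-- `Y` is an `F^α`-scheme on the probability space `(Ω', P')`: independent random variables, the
`n`-th one having the distribution function `F ^ α n`. -/
structure IsFAlphaScheme (F : ℝ → ℝ) (α : ℕ → ℝ) (Y : ℕ → Ω' → ℝ) (P' : Measure Ω') : Prop where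
  measurable : ∀ n, Measurable (Y n)
  indep : iIndepFun Y P'
  cdf_eq : ∀ n x, cdf (P'.map (Y n)) x = F x ^ α n

/-- `X` (on `(Ω, P)`) is a threshold `F^α`-scheme with the continuous distribution function `F`,
the positive exponents `α` of divergent sum, and the nondecreasing thresholds `ℓ`. Here `Y`
(on `(Ω', P')`) is an `F^α`-scheme specified by `F` and `α`; only its law matters. -/
structure IsThresholdScheme (F : ℝ → ℝ) (α ℓ : ℕ → ℝ)
    (X : ℕ → Ω → ℝ) (P : Measure Ω) [IsProbabilityMeasure P]
    (Y : ℕ → Ω' → ℝ) (P' : Measure Ω') [IsProbabilityMeasure P'] : Prop where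
  continuousDF : IsContinuousDF F
  alpha_pos : ∀ n, 0 < α n
  weightSum_tendsto : Tendsto (weightSum α) atTop atTop
  threshold_monotone : Monotone ℓ
  measurable : ∀ n, Measurable (X n)
  /-- The upper end of the support of each `X n` does not exceed that of `F`. -/
  rightEnd_le : ∀ n, rightEnd (cdf (P.map (X n))) ≤ rightEnd F
  /-- No `X n` has an atom at the upper end of the support of `F`. -/
  no_atom : ∀ n, P {ω | (X n ω : EReal) = rightEnd F} = 0
  /-- At and above the threshold, the conditional distribution function of `X n` given the preceding
  observations is the unconditional one. -/
  condCDF_eq : ∀ n, 0 < n →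
    ∀ᵐ y ∂(P.map (fun ω (j : Fin n) => X j ω)), ∀ x, ℓ n ≤ x →
      cdf (condDistrib (X n) (fun ω (j : Fin n) => X j ω) P y) x = cdf (P.map (X n)) x
  /-- The total variations over `(ℓ n, ∞)` of the differences of the laws of `X n` and `Y n` have a
  finite sum. -/
  tv_summable :
    ∑' n, ((P.map (X n)).toSignedMeasure - (P'.map (Y n)).toSignedMeasure).totalVariation
      (Set.Ioi (ℓ n)) < ⊤
  /-- Almost surely, the partial maxima of the `F^α`-scheme eventually exceed the thresholds. -/
  eventually_above : ∀ᵐ ω ∂P', ∀ᶠ n in atTop, ℓ n < partialSups (fun j => Y j ω) n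

/-- The probability that the term with index `k` of the random sequence `Y` is a record. -/
noncomputable def recordProb (Y : ℕ → Ω' → ℝ) (P' : Measure Ω') (k : ℕ) : ℝ :=
  P'.real {ω | recordIndicator (fun j => Y j ω) k = 1}

/-- The mean of the number of records among the first `n` terms of the random sequence `Y`. -/
noncomputable def recordMean (Y : ℕ → Ω' → ℝ) (P' : Measure Ω') (n : ℕ) : ℝ :=
  ∫ ω, recordCount (fun j => Y j ω) n ∂P'

/-- The variance of the number of records among the first `n` terms of the random sequence `Y`. -/
noncomputable def recordVar (Y : ℕ → Ω' → ℝ) (P' : Measure Ω') (n : ℕ) : ℝ :=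
  variance (fun ω => recordCount (fun j => Y j ω) n) P'

end

end RecordScheme

namespace RecordScheme

/-! ### Records of deterministic sequences -/

/-! The record counts of the threshold scheme and of the `F^α`-scheme can be compared through a
coupling that makes them differ eventually by a constant, so it suffices to treat the `F^α`-scheme.

Comparison. Above `ℓ n` the law of `X n` ignores the past, so the truncations `X n ⊔ ℓ n` are
independent (`IsThresholdScheme.iIndepFun_sup`), and their laws differ from those of `Y n ⊔ ℓ n` by
summable total variations. Maximal coupling of each coordinate and Borel–Cantelli give two sequences
that eventually agree (`exists_coupling_eventually_eq`). All terms lie strictly below the right end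
point of `F`, which the `Y n` approach because `s_n → ∞`. The finitely many terms that disagree are
therefore overtaken, and the running maxima eventually coincide. The truncation is harmless too: the
maxima of `Y` eventually exceed the thresholds, and the coupling hands this property to `X`. Records
are the jumps of the running maximum, so the counts differ eventually by a random constant
(`IsThresholdScheme.exists_coupling`). The assertions are insensitive to such a shift, and equality
of laws carries them from one probability space to the other.

The `F^α`-scheme. The identity `P(M < Y ≤ x) = a/(s+a) · F(x)^(s+a)` makes the event of a new record
independent of the new maximum (`indepFun_indicator_sup`). Hence the record indicators are
independent Bernoulli variables with `p_n = α_n/s_n` (`iIndepFun_recordIndicator`, `recordProb_eq`).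
The means diverge by Abel–Dini. The strong law follows from Kolmogorov's criterion and Kronecker's
lemma, and the central limit theorem from characteristic functions. The logarithm enters because
`p_k` is close to `log s_k - log s_{k-1}` when it is small. -/

lemma recordIndicator_succ (x : ℕ → ℝ) (n : ℕ) :
    recordIndicator x (n + 1) = if partialSups x n < partialSups x (n + 1) then 1 else 0 := by
  have h : partialSups x (n + 1) = partialSups x n ⊔ x (n + 1) := partialSups_succ x n
  rw [h]
  simp [recordIndicator]

lemma recordIndicator_nonneg (x : ℕ → ℝ) (n : ℕ) : 0 ≤ recordIndicator x n := by
  cases n with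
  | zero => simp [recordIndicator]
  | succ n => rw [recordIndicator]; split_ifs <;> simp

lemma recordIndicator_le_one (x : ℕ → ℝ) (n : ℕ) : recordIndicator x n ≤ 1 := by
  cases n with
  | zero => simp [recordIndicator]
  | succ n => rw [recordIndicator]; split_ifs <;> simp

lemma recordIndicator_eq_zero_or_one (x : ℕ → ℝ) (n : ℕ) :
    recordIndicator x n = 0 ∨ recordIndicator x n = 1 := by
  cases n with
  | zero => simp [recordIndicator]
  | succ n => rw [recordIndicator]; split_ifs <;> simp

/-- The record counts of two sequences eventually differ by a constant. -/
def CountsTailEquiv (x y : ℕ → ℝ) : Prop :=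
  ∃ c : ℝ, ∀ᶠ n in atTop, recordCount x n = recordCount y n + c

lemma CountsTailEquiv.symm {x y : ℕ → ℝ} (h : CountsTailEquiv x y) : CountsTailEquiv y x := by
  obtain ⟨c, hc⟩ := h
  exact ⟨-c, hc.mono fun n hn => by linarith⟩

/-- If the running maxima eventually agree, so do the record counts up to a constant. -/
lemma countsTailEquiv_of_partialSups {x y : ℕ → ℝ}
    (h : ∀ᶠ n in atTop, partialSups x n = partialSups y n) : CountsTailEquiv x y := by
  obtain ⟨m, hm⟩ := eventually_atTop.1 h
  -- The indicator with index `k + 1` compares the maxima at `k` and `k + 1`, so only indices up to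
  -- `m` can contribute to the discrepancy.
  refine ⟨recordCount x (m + 1) - recordCount y (m + 1), eventually_atTop.2 ⟨m + 1, ?_⟩⟩
  intro n hn
  induction n, hn using Nat.le_induction with
  | base => ring
  | succ n hn ih =>
    obtain ⟨k, rfl⟩ : ∃ k, n = k + 1 := ⟨n - 1, by omega⟩
    have e : recordIndicator x (k + 1) = recordIndicator y (k + 1) := by
      rw [recordIndicator_succ, recordIndicator_succ, hm k (by omega), hm (k + 1) (by omega)]
    have hx : recordCount x (k + 1 + 1) = recordCount x (k + 1) + recordIndicator x (k + 1) :=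
      Finset.sum_range_succ _ _
    have hy : recordCount y (k + 1 + 1) = recordCount y (k + 1) + recordIndicator y (k + 1) :=
      Finset.sum_range_succ _ _
    rw [hx, hy, e, ih]
    ring

/-- Truncation from below by a nondecreasing sequence commutes with running maxima. -/
lemma partialSups_sup_of_monotone (x : ℕ → ℝ) {ℓ : ℕ → ℝ} (hℓ : Monotone ℓ) (n : ℕ) :
    partialSups (fun k => x k ⊔ ℓ k) n = partialSups x n ⊔ ℓ n := by
  apply le_antisymm
  · refine partialSups_le _ _ _ fun j hj => sup_le_sup (le_partialSups_of_le x hj) (hℓ hj)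
  · refine sup_le (partialSups_mono (fun k => le_sup_left) n) ?_
    exact le_trans le_sup_right (le_partialSups (fun k => x k ⊔ ℓ k) n)

/-- The truncated maximum is the larger of the true maximum and `ℓ n`; when it strictly exceeds `ℓ
n` it can only be the true one. -/
lemma partialSups_truncate_eventually_eq {x ℓ : ℕ → ℝ} (hℓ : Monotone ℓ)
    (h : ∀ᶠ n in atTop, ℓ n < partialSups (fun k => x k ⊔ ℓ k) n) :
    ∀ᶠ n in atTop, partialSups (fun k => x k ⊔ ℓ k) n = partialSups x n := by
  filter_upwards [h] with n hn
  rw [partialSups_sup_of_monotone x hℓ] at hn ⊢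
  rcases le_total (partialSups x n) (ℓ n) with h1 | h1
  · rw [sup_eq_right.2 h1] at hn
    exact absurd hn (lt_irrefl _)
  · exact sup_eq_left.2 h1

/-- If two sequences eventually agree and their terms lie below an end point which one of them
approaches, then their running maxima eventually agree. -/
lemma partialSups_eventually_eq {u w : ℕ → ℝ} {b : EReal} (h : ∀ᶠ n in atTop, u n = w n)
    (hu : ∀ k, (u k : EReal) < b) (hw : ∀ k, (w k : EReal) < b)
    (hb : ∀ c : ℝ, (c : EReal) < b → ∃ n, c < w n) :
    ∀ᶠ n in atTop, partialSups u n = partialSups w n := by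
  obtain ⟨m, hm⟩ := eventually_atTop.1 h
  have key : ∀ c : ℝ, (c : EReal) < b → ∀ᶠ n in atTop, c < partialSups w n := by
    intro c hc
    obtain ⟨n, hn⟩ := hb c hc
    exact eventually_atTop.2 ⟨n, fun k hk => hn.trans_le (le_partialSups_of_le w hk)⟩
  -- The terms before `m`, where the sequences may differ, are finitely many and strictly below `b`,
  -- so the maxima of `w` overtake them all.
  have h1 : ∀ᶠ n in atTop, ∀ k ∈ Finset.range m, u k < partialSups w n :=
    (Finset.eventually_all _).2 fun k _ => key _ (hu k)
  have h2 : ∀ᶠ n in atTop, ∀ k ∈ Finset.range m, w k < partialSups w n :=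
    (Finset.eventually_all _).2 fun k _ => key _ (hw k)
  filter_upwards [h1, h2] with n h1 h2
  apply le_antisymm
  · obtain ⟨j, hj, e⟩ := exists_partialSups_eq u n
    rw [e]
    by_cases hjm : j < m
    · exact (h1 j (Finset.mem_range.2 hjm)).le
    · rw [hm j (not_lt.1 hjm)]
      exact le_partialSups_of_le w hj
  · obtain ⟨j, hj, e⟩ := exists_partialSups_eq w n
    by_cases hjm : j < m
    · exact absurd (h2 j (Finset.mem_range.2 hjm)) (by rw [e]; exact lt_irrefl _)
    · rw [e, ← hm j (not_lt.1 hjm)]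
      exact le_partialSups_of_le u hj

lemma measurable_partialSups (n : ℕ) : Measurable fun x : ℕ → ℝ => partialSups x n := by
  induction n with
  | zero => simpa using measurable_pi_apply 0
  | succ n ih =>
    have : (fun x : ℕ → ℝ => partialSups x (n + 1)) =
        fun x => partialSups x n ⊔ x (n + 1) := by
      ext x; exact partialSups_succ x n
    rw [this]
    exact ih.sup (measurable_pi_apply _)

lemma measurable_recordIndicator (n : ℕ) : Measurable fun x : ℕ → ℝ => recordIndicator x n := by
  cases n with
  | zero => simp [recordIndicator]
  | succ n =>
    simp only [recordIndicator]
    exact Measurable.ite (measurableSet_lt (measurable_partialSups n) (measurable_pi_apply _))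
      measurable_const measurable_const

lemma measurable_recordCount (n : ℕ) : Measurable fun x : ℕ → ℝ => recordCount x n :=
  Finset.measurable_sum _ fun k _ => measurable_recordIndicator k

/-! ### Laws with a continuous distribution function -/

lemma nullSingletonClass_of_continuous_cdf (μ : Measure ℝ) [IsProbabilityMeasure μ]
    (h : Continuous (cdf μ)) : NullSingletonClass μ := by
  refine ⟨fun a => ?_⟩
  have := (cdf μ).measure_singleton a
  rw [measure_cdf] at this
  rw [this, (h.continuousAt.continuousWithinAt).leftLim_eq]
  simp

lemma IsContinuousDF.nonneg {F : ℝ → ℝ} (hF : IsContinuousDF F) (x : ℝ) : 0 ≤ F x :=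
  hF.monotone.le_of_tendsto hF.tendsto_atBot x

lemma IsContinuousDF.continuous_rpow {F : ℝ → ℝ} (hF : IsContinuousDF F) {a : ℝ} (ha : 0 < a) :
    Continuous fun x => F x ^ a :=
  hF.continuous.rpow_const fun _ => Or.inr ha.le

/-- The **probability integral transform**: a continuous distribution function maps its law to the
uniform distribution on the unit interval. -/
lemma map_cdf_of_continuous (μ : Measure ℝ) [IsProbabilityMeasure μ] (h : Continuous (cdf μ)) :
    μ.map (cdf μ) = volume.restrict (Set.Icc 0 1) := by
  have hm : Measurable (cdf μ) := h.measurable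
  have hrange : ∀ v : ℝ, 0 < v → v < 1 → ∃ y, cdf μ y = v := fun v h0 h1 =>
    mem_range_of_exists_le_of_exists_ge h
      (((tendsto_cdf_atBot μ).eventually_le_const h0).exists)
      (((tendsto_cdf_atTop μ).eventually_const_le h1).exists)
  have : IsProbabilityMeasure (μ.map (cdf μ)) := Measure.isProbabilityMeasure_map hm.aemeasurable
  refine Measure.ext_of_Iic _ _ fun u => ?_
  rw [Measure.map_apply hm measurableSet_Iic, Measure.restrict_apply measurableSet_Iic]
  rcases lt_or_ge u 0 with hu | hu
  · have e1 : (cdf μ) ⁻¹' Set.Iic u = ∅ := by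
      ext x
      simp only [Set.mem_preimage, Set.mem_Iic, Set.mem_empty_iff_false, iff_false, not_le]
      exact hu.trans_le (cdf_nonneg μ x)
    have e2 : Set.Iic u ∩ Set.Icc (0 : ℝ) 1 = ∅ := by
      ext x
      simp only [Set.mem_inter_iff, Set.mem_Iic, Set.mem_Icc, Set.mem_empty_iff_false, iff_false]
      rintro ⟨h1, h2, -⟩
      linarith
    rw [e1, e2]
    simp
  rcases le_or_gt 1 u with hu1 | hu1
  · have e1 : (cdf μ) ⁻¹' Set.Iic u = Set.univ := by
      ext x
      simpa using (cdf_le_one μ x).trans hu1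
    have e2 : Set.Iic u ∩ Set.Icc (0 : ℝ) 1 = Set.Icc 0 1 := by
      ext x
      simp only [Set.mem_inter_iff, Set.mem_Iic, Set.mem_Icc]
      constructor
      · exact fun h => h.2
      · exact fun h => ⟨h.2.trans hu1, h⟩
    rw [e1, e2]
    simp
  have e2 : Set.Iic u ∩ Set.Icc (0 : ℝ) 1 = Set.Icc 0 u := by
    ext x
    simp only [Set.mem_inter_iff, Set.mem_Iic, Set.mem_Icc]
    constructor
    · exact fun h => ⟨h.2.1, h.1⟩
    · exact fun h => ⟨h.2, h.1, h.2.trans hu1.le⟩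
  rw [e2, Real.volume_Icc, sub_zero]
  apply le_antisymm
  -- A level `v` slightly above `u` is attained at some `y`, and the preimage of `Iic u` lies below
  -- `y`, even if the distribution function is flat at height `u`.
  · refine ENNReal.le_of_forall_pos_le_add fun ε hε _ => ?_
    have hε' : (0 : ℝ) < ε := hε
    obtain ⟨v, hv1, hv2⟩ := exists_between (lt_min hu1 (lt_add_of_pos_right u hε'))
    obtain ⟨y, hy⟩ := hrange v (hu.trans_lt hv1) (hv2.trans_le (min_le_left _ _))
    calc μ ((cdf μ) ⁻¹' Set.Iic u) ≤ μ (Set.Iic y) := by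
          refine measure_mono fun z hz => ?_
          by_contra hzy
          have : cdf μ y ≤ cdf μ z := monotone_cdf μ (not_le.1 hzy).le
          have hz' : cdf μ z ≤ u := hz
          linarith
      _ = ENNReal.ofReal v := by rw [← ofReal_cdf, hy]
      _ ≤ ENNReal.ofReal (u + ε) :=
          ENNReal.ofReal_le_ofReal (hv2.le.trans (min_le_right _ _))
      _ = ENNReal.ofReal u + ε := by
          rw [ENNReal.ofReal_add hu hε'.le, ENNReal.ofReal_coe_nnreal]
  -- The value `0` need not be attained, but there the lower bound is trivial.
  · rcases hu.eq_or_lt with rfl | hu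
    · simp
    · obtain ⟨y, hy⟩ := hrange u hu hu1
      rw [← hy, ofReal_cdf]
      exact measure_mono fun z hz => monotone_cdf μ hz

/-- The integral of a power of a continuous distribution function against its law. -/
lemma setLIntegral_cdf_rpow (μ : Measure ℝ) [IsProbabilityMeasure μ] (h : Continuous (cdf μ))
    {r : ℝ} (hr : 0 < r) (x : ℝ) :
    ∫⁻ y in Set.Iic x, ENNReal.ofReal (cdf μ y ^ r) ∂μ =
      ENNReal.ofReal (cdf μ x ^ (r + 1) / (r + 1)) := by
  have hm : Measurable (cdf μ) := h.measurable
  set c := cdf μ x with hc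
  have hc0 : 0 ≤ c := cdf_nonneg μ x
  have hc1 : c ≤ 1 := cdf_le_one μ x
  have hmap := map_cdf_of_continuous μ h
  have hinter : Set.Iic c ∩ Set.Icc (0 : ℝ) 1 = Set.Icc 0 c := by
    ext z
    simp only [Set.mem_inter_iff, Set.mem_Iic, Set.mem_Icc]
    exact ⟨fun h => ⟨h.2.1, h.1⟩, fun h => ⟨h.2, h.1, h.2.trans hc1⟩⟩
  -- The preimage may be larger if the distribution function is flat to the right of `x`; both sets
  -- have mass `c`.
  have hae : Set.Iic x =ᵐ[μ] (cdf μ) ⁻¹' Set.Iic c := by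
    refine ae_eq_of_subset_of_measure_ge (fun z hz => monotone_cdf μ hz) ?_
      measurableSet_Iic.nullMeasurableSet (measure_ne_top _ _)
    rw [← Measure.map_apply hm measurableSet_Iic, hmap, Measure.restrict_apply measurableSet_Iic,
      hinter, Real.volume_Icc, sub_zero, hc, ofReal_cdf]
  have hmeas : Measurable fun u : ℝ => ENNReal.ofReal (u ^ r) := by fun_prop
  rw [setLIntegral_congr hae, ← setLIntegral_map measurableSet_Iic hmeas hm, hmap,
    Measure.restrict_restrict measurableSet_Iic, hinter]
  have hcont : Continuous fun u : ℝ => u ^ r := continuous_id.rpow_const fun _ => Or.inr hr.le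
  rw [← ofReal_integral_eq_lintegral_ofReal (hcont.integrableOn_Icc)]
  · rw [integral_Icc_eq_integral_Ioc, ← intervalIntegral.integral_of_le hc0,
      integral_rpow (Or.inl (by linarith)), Real.zero_rpow (by linarith), sub_zero]
  · filter_upwards [ae_restrict_mem measurableSet_Icc] with u hu
    exact Real.rpow_nonneg hu.1 _

/-- `F ^ s` is the power `s / a` of the distribution function `F ^ a`, which is uniform under its
own law. -/
lemma setLIntegral_rpow_of_cdf_eq {F : ℝ → ℝ} (hF : IsContinuousDF F) (μ : Measure ℝ)
    [IsProbabilityMeasure μ] {a s : ℝ} (ha : 0 < a) (hs : 0 < s) (hμ : ∀ x, cdf μ x = F x ^ a)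
    (x : ℝ) :
    ∫⁻ y in Set.Iic x, ENNReal.ofReal (F y ^ s) ∂μ =
      ENNReal.ofReal (a / (s + a) * F x ^ (s + a)) := by
  have hfun : (cdf μ : ℝ → ℝ) = fun x => F x ^ a := funext hμ
  have hcont : Continuous (cdf μ) := by rw [hfun]; exact hF.continuous_rpow ha
  have e : ∀ y, F y ^ s = cdf μ y ^ (s / a) := fun y => by
    rw [hμ, ← Real.rpow_mul (hF.nonneg y)]
    congr 1
    field_simp
  simp_rw [e]
  rw [setLIntegral_cdf_rpow μ hcont (by positivity) x, hμ, ← Real.rpow_mul (hF.nonneg x)]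
  congr 1
  have e1 : a * (s / a + 1) = s + a := by field_simp
  rw [e1]
  field_simp

/-! ### Two independent variables whose distribution functions are powers of `F` -/

section TwoVariables

variable {Ω : Type*} [MeasurableSpace Ω] {P : Measure Ω} [IsProbabilityMeasure P]
  {F : ℝ → ℝ} {M Y : Ω → ℝ} {s a : ℝ}

/-- Given `Y = y`, the event `M < y` has probability `F y ^ s` because `M` has no atoms; this is
integrated over `y ≤ x`. -/
lemma measure_lt_inter_le (hF : IsContinuousDF F) (hM : Measurable M) (hY : Measurable Y)
    (hind : IndepFun M Y P) (hs : 0 < s) (ha : 0 < a) (hMF : ∀ x, cdf (P.map M) x = F x ^ s)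
    (hYF : ∀ x, cdf (P.map Y) x = F x ^ a) (x : ℝ) :
    P {ω | M ω < Y ω ∧ Y ω ≤ x} = ENNReal.ofReal (a / (s + a) * F x ^ (s + a)) := by
  have : IsProbabilityMeasure (P.map M) := Measure.isProbabilityMeasure_map hM.aemeasurable
  have : IsProbabilityMeasure (P.map Y) := Measure.isProbabilityMeasure_map hY.aemeasurable
  have hMna : NullSingletonClass (P.map M) := by
    refine nullSingletonClass_of_continuous_cdf _ ?_
    rw [show (cdf (P.map M) : ℝ → ℝ) = fun x => F x ^ s from funext hMF]
    exact hF.continuous_rpow hs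
  have hset : MeasurableSet {z : ℝ × ℝ | z.1 < z.2 ∧ z.2 ≤ x} :=
    (measurableSet_lt measurable_fst measurable_snd).inter
      (measurableSet_le measurable_snd measurable_const)
  have e1 : P {ω | M ω < Y ω ∧ Y ω ≤ x} =
      P.map (fun ω => (M ω, Y ω)) {z : ℝ × ℝ | z.1 < z.2 ∧ z.2 ≤ x} := by
    rw [Measure.map_apply (hM.prodMk hY) hset]
    rfl
  rw [e1, (indepFun_iff_map_prod_eq_prod_map_map hM.aemeasurable hY.aemeasurable).1 hind,
    Measure.prod_apply_symm hset, ← setLIntegral_rpow_of_cdf_eq hF _ ha hs hYF x,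
    ← lintegral_indicator measurableSet_Iic]
  refine lintegral_congr fun y => ?_
  by_cases hy : y ≤ x
  · rw [Set.indicator_of_mem (by exact hy), ← hMF, ofReal_cdf, ← measure_congr Iio_ae_eq_Iic]
    congr 1
    ext z
    simp [hy]
  · rw [Set.indicator_of_notMem (by exact hy)]
    have : (fun z : ℝ => (z, y)) ⁻¹' {z : ℝ × ℝ | z.1 < z.2 ∧ z.2 ≤ x} = ∅ := by
      ext z
      simp [hy]
    rw [this, measure_empty]

lemma measure_lt_eq (hF : IsContinuousDF F) (hM : Measurable M) (hY : Measurable Y)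
    (hind : IndepFun M Y P) (hs : 0 < s) (ha : 0 < a) (hMF : ∀ x, cdf (P.map M) x = F x ^ s)
    (hYF : ∀ x, cdf (P.map Y) x = F x ^ a) :
    P {ω | M ω < Y ω} = ENNReal.ofReal (a / (s + a)) := by
  have hset : MeasurableSet {ω | M ω < Y ω} := measurableSet_lt hM hY
  have h1 := tendsto_measure_Iic_atTop ((P.restrict {ω | M ω < Y ω}).map Y)
  rw [Measure.map_apply hY .univ, Set.preimage_univ, Measure.restrict_apply_univ] at h1
  have h2 : Tendsto (fun x => ENNReal.ofReal (a / (s + a) * F x ^ (s + a))) atTop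
      (𝓝 (ENNReal.ofReal (a / (s + a) * 1 ^ (s + a)))) :=
    ENNReal.tendsto_ofReal ((hF.tendsto_atTop.rpow_const (Or.inl one_ne_zero)).const_mul _)
  rw [Real.one_rpow, mul_one] at h2
  refine tendsto_nhds_unique h1 (h2.congr fun x => ?_)
  rw [Measure.map_apply hY measurableSet_Iic, Measure.restrict_apply (hY measurableSet_Iic),
    ← measure_lt_inter_le hF hM hY hind hs ha hMF hYF x]
  congr 1
  ext ω
  simp [and_comm]

lemma cdf_map_sup (hM : Measurable M) (hY : Measurable Y) (hind : IndepFun M Y P) (x : ℝ) :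
    cdf (P.map fun ω => M ω ⊔ Y ω) x = cdf (P.map M) x * cdf (P.map Y) x := by
  have : IsProbabilityMeasure (P.map M) := Measure.isProbabilityMeasure_map hM.aemeasurable
  have : IsProbabilityMeasure (P.map Y) := Measure.isProbabilityMeasure_map hY.aemeasurable
  have : IsProbabilityMeasure (P.map fun ω => M ω ⊔ Y ω) :=
    Measure.isProbabilityMeasure_map (hM.sup hY).aemeasurable
  have hsup : Measurable fun ω => M ω ⊔ Y ω := hM.sup hY
  rw [cdf_eq_real, cdf_eq_real, cdf_eq_real, measureReal_def, measureReal_def, measureReal_def,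
    Measure.map_apply hM measurableSet_Iic, Measure.map_apply hY measurableSet_Iic,
    Measure.map_apply hsup measurableSet_Iic, ← ENNReal.toReal_mul,
    ← hind.measure_inter_preimage_eq_mul _ _ measurableSet_Iic measurableSet_Iic]
  congr 2
  ext ω
  simp

/-- The event that the second variable is the larger one is independent of the maximum. -/
lemma indepFun_indicator_sup (hF : IsContinuousDF F) (hM : Measurable M) (hY : Measurable Y)
    (hind : IndepFun M Y P) (hs : 0 < s) (ha : 0 < a) (hMF : ∀ x, cdf (P.map M) x = F x ^ s)
    (hYF : ∀ x, cdf (P.map Y) x = F x ^ a) :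
    IndepFun ({ω | M ω < Y ω}.indicator fun _ => (1 : ℝ)) (fun ω => M ω ⊔ Y ω) P := by
  have hset : MeasurableSet {ω | M ω < Y ω} := measurableSet_lt hM hY
  have hsup : Measurable fun ω => M ω ⊔ Y ω := hM.sup hY
  -- On the event `M < Y` the maximum is `Y`, and the probability that it is at most `x` factors
  -- into `a / (s + a)` and the distribution function `F x ^ (s + a)` of the maximum.
  have hlaw : (P.restrict {ω | M ω < Y ω}).map (fun ω => M ω ⊔ Y ω) =
      P {ω | M ω < Y ω} • P.map (fun ω => M ω ⊔ Y ω) := by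
    refine Measure.ext_of_Iic _ _ fun x => ?_
    have : IsProbabilityMeasure (P.map fun ω => M ω ⊔ Y ω) :=
      Measure.isProbabilityMeasure_map hsup.aemeasurable
    rw [Measure.map_apply hsup measurableSet_Iic, Measure.restrict_apply (hsup measurableSet_Iic),
      Measure.smul_apply, ← ofReal_cdf (P.map fun ω => M ω ⊔ Y ω), cdf_map_sup hM hY hind, hMF, hYF,
      measure_lt_eq hF hM hY hind hs ha hMF hYF, smul_eq_mul,
      ← Real.rpow_add_of_nonneg (hF.nonneg x) hs.le ha.le, ← ENNReal.ofReal_mul (by positivity),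
      ← measure_lt_inter_le hF hM hY hind hs ha hMF hYF x]
    congr 1
    ext ω
    simp only [Set.mem_inter_iff, Set.mem_preimage, Set.mem_Iic, sup_le_iff, Set.mem_ofPred_eq]
    constructor
    · exact fun h => ⟨h.2, h.1.2⟩
    · exact fun h => ⟨⟨h.1.le.trans h.2, h.2⟩, h.1⟩
  have hset_ind : IndepSets {{ω | M ω < Y ω}}
      {t | MeasurableSet[MeasurableSpace.comap (fun ω => M ω ⊔ Y ω) inferInstance] t} P := by
    rw [IndepSets_iff]
    rintro _ _ rfl ⟨t, ht, rfl⟩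
    have := congrArg (fun μ => μ t) hlaw
    simp only [Measure.map_apply hsup ht, Measure.restrict_apply (hsup ht), Measure.smul_apply,
      smul_eq_mul] at this
    rw [Set.inter_comm]
    exact this
  rw [IndepFun_iff_Indep]
  have hI : Indep (MeasurableSpace.generateFrom {{ω | M ω < Y ω}})
      (MeasurableSpace.comap (fun ω => M ω ⊔ Y ω) inferInstance) P := by
    refine IndepSets.indep ?_ hsup.comap_le (IsPiSystem.singleton _)
      (@MeasurableSpace.isPiSystem_measurableSet Ω
        (MeasurableSpace.comap (fun ω => M ω ⊔ Y ω) inferInstance)) rfl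
      (@MeasurableSpace.generateFrom_measurableSet Ω
        (MeasurableSpace.comap (fun ω => M ω ⊔ Y ω) inferInstance)).symm hset_ind
    rw [MeasurableSpace.generateFrom_le_iff]
    rintro _ rfl
    exact hset
  refine indep_of_indep_of_le_left hI ?_
  rw [← measurable_iff_comap_le]
  refine Measurable.indicator measurable_const ?_
  exact MeasurableSpace.measurableSet_generateFrom rfl

end TwoVariables

/-! ### Independence of the record indicators of an `F^α`-scheme -/

section Indep

variable {Ω : Type*} [MeasurableSpace Ω] {P : Measure Ω} [IsProbabilityMeasure P]
  {β γ δ : Type*} [MeasurableSpace β] [MeasurableSpace γ] [MeasurableSpace δ]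

/-- The two hypotheses make the joint law the product of three laws, which can be regrouped by
associativity. -/
lemma indepFun_prodMk_right {f : Ω → β} {g : Ω → γ} {h : Ω → δ} (hf : Measurable f)
    (hg : Measurable g) (hh : Measurable h) (hfg : IndepFun f g P)
    (hfgh : IndepFun (fun ω => (f ω, g ω)) h P) : IndepFun f (fun ω => (g ω, h ω)) P := by
  have hgh : IndepFun g h P := hfgh.comp measurable_snd measurable_id
  have := Measure.isProbabilityMeasure_map (μ := P) hf.aemeasurable
  have := Measure.isProbabilityMeasure_map (μ := P) hg.aemeasurable
  have := Measure.isProbabilityMeasure_map (μ := P) hh.aemeasurable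
  rw [indepFun_iff_map_prod_eq_prod_map_map (by fun_prop) (by fun_prop)] at hfg hfgh hgh ⊢
  rw [hgh, ← Measure.prodAssoc_prod, ← hfg, ← hfgh,
    Measure.map_map MeasurableEquiv.prodAssoc.measurable (by fun_prop)]
  rfl

lemma indepFun_prodMk_left {f : Ω → β} {g : Ω → γ} {h : Ω → δ} (hf : Measurable f)
    (hg : Measurable g) (hh : Measurable h) (hgh : IndepFun g h P)
    (hfgh : IndepFun f (fun ω => (g ω, h ω)) P) : IndepFun (fun ω => (f ω, g ω)) h P := by
  have h1 : IndepFun (fun ω => (h ω, g ω)) f P :=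
    (hfgh.comp measurable_id measurable_swap).symm
  have h2 := indepFun_prodMk_right hh hg hf hgh.symm h1
  exact (h2.comp measurable_id measurable_swap).symm

/-- A sequence is independent if each term is independent of the preceding ones. -/
lemma iIndepFun_of_indepFun_prefix {f : ℕ → Ω → β}
    (h : ∀ n, IndepFun (fun ω (j : Fin n) => f j ω) (f n) P) : iIndepFun f P := by
  rw [iIndepFun_iff_measure_inter_preimage_eq_mul]
  intro S
  -- Indices are added in increasing order, so the event for `S` depends only on terms before the
  -- new index.
  induction S using Finset.induction_on_max with
  | empty => simp
  | insert a S hS ih =>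
    intro sets hsets
    have haS : a ∉ S := fun h => lt_irrefl _ (hS a h)
    rw [Finset.set_biInter_insert, Finset.prod_insert haS,
      ← ih fun i hi => hsets i (Finset.mem_insert_of_mem hi), Set.inter_comm, mul_comm]
    have e : ⋂ i ∈ S, f i ⁻¹' sets i = (fun ω (j : Fin a) => f j ω) ⁻¹'
        ⋂ j : Fin a, {x | (j : ℕ) ∈ S → x j ∈ sets j} := by
      ext ω
      simp only [Set.mem_iInter, Set.mem_preimage, Set.mem_ofPred_eq]
      exact ⟨fun H j hj => H j hj, fun H i hi => H ⟨i, hS i hi⟩ hi⟩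
    rw [e]
    refine (h a).measure_inter_preimage_eq_mul _ _ ?_ (hsets a (Finset.mem_insert_self _ _))
    refine MeasurableSet.iInter fun j => ?_
    by_cases hj : (j : ℕ) ∈ S
    · simp only [hj, true_imp_iff]
      exact measurable_pi_apply j (hsets j (Finset.mem_insert_of_mem hj))
    · simp [hj]

end Indep

/-! ### Functionals of the first terms and their independence of the next one -/

lemma partialSups_congr_of_le {x y : ℕ → ℝ} {n : ℕ} (h : ∀ k ≤ n, x k = y k) :
    partialSups x n = partialSups y n := by
  apply le_antisymm
  · exact partialSups_le _ _ _ fun j hj => (h j hj).le.trans (le_partialSups_of_le y hj)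
  · exact partialSups_le _ _ _ fun j hj => (h j hj).ge.trans (le_partialSups_of_le x hj)

lemma recordIndicator_congr_of_le {x y : ℕ → ℝ} {n : ℕ} (h : ∀ k ≤ n, x k = y k) :
    recordIndicator x n = recordIndicator y n := by
  cases n with
  | zero => rfl
  | succ n =>
    rw [recordIndicator, recordIndicator, h (n + 1) le_rfl,
      partialSups_congr_of_le fun k hk => h k (by omega)]

lemma weightSum_succ (α : ℕ → ℝ) (n : ℕ) : weightSum α (n + 1) = weightSum α n + α n :=
  Finset.sum_range_succ _ _

lemma weightSum_pos {α : ℕ → ℝ} (hα : ∀ n, 0 < α n) (n : ℕ) : 0 < weightSum α (n + 1) :=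
  Finset.sum_pos (fun k _ => hα k) ⟨0, by simp⟩

/-- Stopping at `n` leaves an infinite sequence, to which records and running maxima apply directly,
although it involves only the terms up to `n`. -/
lemma indepFun_stopped_succ {Ω : Type*} [MeasurableSpace Ω] {P : Measure Ω} {Y : ℕ → Ω → ℝ}
    (hY : ∀ n, Measurable (Y n)) (hind : iIndepFun Y P) (n : ℕ) :
    IndepFun (fun ω (k : ℕ) => Y (min k n) ω) (Y (n + 1)) P := by
  have h1 := (hind.indep_comap_natural_of_lt (fun i => (hY i).stronglyMeasurable)
    (Nat.lt_succ_self n)).symm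
  rw [IndepFun_iff_Indep]
  refine indep_of_indep_of_le_left h1 ?_
  rw [← measurable_iff_comap_le]
  refine @measurable_pi_lambda _ _ _ (_) _ _ fun k => ?_
  refine Measurable.mono (comap_measurable (Y (min k n))) ?_ le_rfl
  exact le_iSup₂_of_le (min k n) (min_le_right _ _) le_rfl

lemma recordIndicator_succ_eq_indicator {Ω : Type*} (Y : ℕ → Ω → ℝ) (n : ℕ) :
    (fun ω => recordIndicator (fun i => Y i ω) (n + 1)) =
      {ω | partialSups (fun i => Y i ω) n < Y (n + 1) ω}.indicator fun _ => (1 : ℝ) := by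
  ext ω
  simp only [recordIndicator, Set.indicator_apply, Set.mem_ofPred_eq]

lemma indepFun_records_max_next {Ω : Type*} [MeasurableSpace Ω] {P : Measure Ω} {Y : ℕ → Ω → ℝ}
    (hY : ∀ n, Measurable (Y n)) (hind : iIndepFun Y P) (n : ℕ) :
    IndepFun (fun ω => ((fun j : Fin (n + 1) => recordIndicator (fun i => Y i ω) j),
      partialSups (fun i => Y i ω) n)) (Y (n + 1)) P := by
  have hφ : Measurable fun x : ℕ → ℝ =>
      ((fun j : Fin (n + 1) => recordIndicator x j), partialSups x n) :=
    Measurable.prodMk (measurable_pi_lambda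
      (fun (x : ℕ → ℝ) (j : Fin (n + 1)) => recordIndicator x j)
      fun j => measurable_recordIndicator (j : ℕ)) (measurable_partialSups n)
  have := (indepFun_stopped_succ hY hind n).comp hφ measurable_id
  refine this.congr (ae_of_all _ fun ω => ?_) (ae_of_all _ fun _ => rfl)
  refine Prod.ext (funext fun j => ?_) ?_
  · refine recordIndicator_congr_of_le fun k hk => ?_
    change Y (min k n) ω = Y k ω
    rw [min_eq_left (by omega)]
  · refine partialSups_congr_of_le fun k hk => ?_
    change Y (min k n) ω = Y k ω
    rw [min_eq_left hk]

section Scheme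

variable {Ω : Type*} [MeasurableSpace Ω] {P : Measure Ω} [IsProbabilityMeasure P]
  {F : ℝ → ℝ} {α : ℕ → ℝ} {Y : ℕ → Ω → ℝ}

lemma measurable_partialSups_comp (hY : ∀ n, Measurable (Y n)) (n : ℕ) :
    Measurable fun ω => partialSups (fun j => Y j ω) n :=
  (measurable_partialSups n).comp (measurable_pi_lambda _ hY)

lemma measurable_recordIndicator_comp (hY : ∀ n, Measurable (Y n)) (n : ℕ) :
    Measurable fun ω => recordIndicator (fun j => Y j ω) n :=
  (measurable_recordIndicator n).comp (measurable_pi_lambda _ hY)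

lemma cdf_partialSups (hα : ∀ n, 0 < α n) (hF : IsContinuousDF F) (h : IsFAlphaScheme F α Y P)
    (n : ℕ) (x : ℝ) :
    cdf (P.map fun ω => partialSups (fun i => Y i ω) n) x = F x ^ weightSum α (n + 1) := by
  induction n generalizing x with
  | zero => simpa [weightSum] using h.cdf_eq 0 x
  | succ n ih =>
    have e : (fun ω => partialSups (fun i => Y i ω) (n + 1)) =
        fun ω => partialSups (fun i => Y i ω) n ⊔ Y (n + 1) ω := by
      ext ω; exact partialSups_succ _ n
    have hi : IndepFun (fun ω => partialSups (fun i => Y i ω) n) (Y (n + 1)) P :=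
      (indepFun_records_max_next h.measurable h.indep n).comp measurable_snd measurable_id
    rw [e, cdf_map_sup (measurable_partialSups_comp h.measurable n) (h.measurable _) hi, ih,
      h.cdf_eq, ← Real.rpow_add_of_nonneg (hF.nonneg x) (weightSum_pos hα n).le (hα _).le,
      ← weightSum_succ]

/-- Let `R` be the past indicators, `M` the maximum and `Y` the next term. By induction `R` is
independent of `M`, and `(R, M)` of `Y`, so `R` is independent of `(M, Y)`. The new indicator and
the new maximum are functions of `(M, Y)` and independent of each other, so the new indicator can be
joined to `R`. -/
lemma indepFun_records_max (hα : ∀ n, 0 < α n) (hF : IsContinuousDF F)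
    (h : IsFAlphaScheme F α Y P) (n : ℕ) :
    IndepFun (fun ω (j : Fin (n + 1)) => recordIndicator (fun i => Y i ω) j)
      (fun ω => partialSups (fun i => Y i ω) n) P := by
  induction n with
  | zero =>
    have e : (fun ω (j : Fin (0 + 1)) => recordIndicator (fun i => Y i ω) j) =
        fun _ _ => (1 : ℝ) := by
      ext ω j
      have : (j : ℕ) = 0 := by omega
      rw [this]
      rfl
    rw [e]
    exact indepFun_const_left _ _
  | succ n ih =>
    have hM := measurable_partialSups_comp h.measurable n
    have hR := measurable_recordIndicator_comp h.measurable (n + 1)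
    have hV : Measurable fun ω (j : Fin (n + 1)) => recordIndicator (fun i => Y i ω) j :=
      measurable_pi_lambda _ fun j => measurable_recordIndicator_comp h.measurable j
    have hnext := indepFun_records_max_next h.measurable h.indep n
    have hMY : IndepFun (fun ω => partialSups (fun i => Y i ω) n) (Y (n + 1)) P :=
      hnext.comp measurable_snd measurable_id
    have h1 := indepFun_prodMk_right hV hM (h.measurable (n + 1)) ih hnext
    have h2 := indepFun_indicator_sup hF hM (h.measurable (n + 1)) hMY (weightSum_pos hα n)
      (hα (n + 1)) (cdf_partialSups hα hF h n) (h.cdf_eq (n + 1))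
    rw [← recordIndicator_succ_eq_indicator] at h2
    have hφ : Measurable fun z : ℝ × ℝ =>
        ((if z.1 < z.2 then (1 : ℝ) else 0), z.1 ⊔ z.2) :=
      (Measurable.ite (measurableSet_lt measurable_fst measurable_snd) measurable_const
        measurable_const).prodMk (measurable_fst.sup measurable_snd)
    have h3 : IndepFun (fun ω (j : Fin (n + 1)) => recordIndicator (fun i => Y i ω) j)
        (fun ω => (recordIndicator (fun i => Y i ω) (n + 1),
          partialSups (fun i => Y i ω) n ⊔ Y (n + 1) ω)) P := h1.comp measurable_id hφ
    have h4 := indepFun_prodMk_left hV hR (hM.sup (h.measurable (n + 1))) h2 h3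
    have hψ : Measurable fun z : (Fin (n + 1) → ℝ) × ℝ =>
        (Fin.snoc z.1 z.2 : Fin (n + 1 + 1) → ℝ) := by
      refine measurable_pi_lambda _ fun j => ?_
      refine Fin.lastCases ?_ (fun i => ?_) j
      · simpa using measurable_snd
      · simpa [Function.comp_def] using (measurable_pi_apply i).comp measurable_fst
    have h5 := h4.comp hψ measurable_id
    convert h5 using 1
    · ext ω j
      refine Fin.lastCases ?_ (fun i => ?_) j
      · simp
      · simp
    · ext ω
      exact partialSups_succ _ n

/-- **Rényi's theorem** for `F^α`-schemes: the record indicators are independent. -/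
theorem iIndepFun_recordIndicator (hα : ∀ n, 0 < α n) (hF : IsContinuousDF F)
    (h : IsFAlphaScheme F α Y P) :
    iIndepFun (fun n ω => recordIndicator (fun i => Y i ω) n) P := by
  refine iIndepFun_of_indepFun_prefix fun n => ?_
  cases n with
  | zero => exact (indepFun_const_left (fun _ : Fin 0 => (0 : ℝ)) _).congr (ae_of_all _ fun ω => by
      ext j; exact j.elim0) (ae_of_all _ fun _ => rfl)
  | succ n =>
    have hM := measurable_partialSups_comp h.measurable n
    have hV : Measurable fun ω (j : Fin (n + 1)) => recordIndicator (fun i => Y i ω) j :=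
      measurable_pi_lambda _ fun j => measurable_recordIndicator_comp h.measurable j
    have h1 := indepFun_prodMk_right hV hM (h.measurable (n + 1)) (indepFun_records_max hα hF h n)
      (indepFun_records_max_next h.measurable h.indep n)
    exact h1.comp measurable_id (Measurable.ite (measurableSet_lt measurable_fst measurable_snd)
        measurable_const measurable_const : Measurable fun z : ℝ × ℝ =>
        if z.1 < z.2 then (1 : ℝ) else 0)

lemma recordProb_eq (hα : ∀ n, 0 < α n) (hF : IsContinuousDF F) (h : IsFAlphaScheme F α Y P)
    (n : ℕ) : recordProb Y P n = α n / weightSum α (n + 1) := by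
  cases n with
  | zero => simp [recordProb, recordIndicator, weightSum, (hα 0).ne']
  | succ n =>
    have e : {ω | recordIndicator (fun j => Y j ω) (n + 1) = 1} =
        {ω | partialSups (fun i => Y i ω) n < Y (n + 1) ω} := by
      ext ω
      simp [recordIndicator]
    have hMY : IndepFun (fun ω => partialSups (fun i => Y i ω) n) (Y (n + 1)) P :=
      (indepFun_records_max_next h.measurable h.indep n).comp measurable_snd measurable_id
    have hs := weightSum_pos hα n
    have ha := hα (n + 1)
    rw [recordProb, e, measureReal_def, measure_lt_eq hF (measurable_partialSups_comp h.measurable n)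
      (h.measurable (n + 1)) hMY hs ha (cdf_partialSups hα hF h n) (h.cdf_eq (n + 1)),
      ENNReal.toReal_ofReal (by positivity), weightSum_succ α (n + 1)]

end Scheme

/-! ### Limit theorems for sums of independent random variables -/

section Sums

variable {Ω : Type*} [MeasurableSpace Ω] {P : Measure Ω} [IsProbabilityMeasure P]
  {η : ℕ → Ω → ℝ}

lemma integral_sq_sum_of_iIndepFun (hL : ∀ n, MemLp (η n) 2 P)
    (hind : iIndepFun η P) (h0 : ∀ n, ∫ ω, η n ω ∂P = 0) (n : ℕ) :
    ∫ ω, (∑ k ∈ Finset.range n, η k ω) ^ 2 ∂P =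
      ∑ k ∈ Finset.range n, ∫ ω, η k ω ^ 2 ∂P := by
  have hvar : ∀ k, Var[η k; P] = ∫ ω, η k ω ^ 2 ∂P := fun k =>
    variance_of_integral_eq_zero (hL k).aemeasurable (h0 k)
  have h1 := IndepFun.variance_sum (s := Finset.range n) (fun i _ => hL i)
    fun i _ j _ hij => hind.indepFun hij
  have hm : AEMeasurable (∑ k ∈ Finset.range n, η k) P :=
    (memLp_finsetSum' _ fun i _ => hL i).aemeasurable
  have hz : ∫ ω, (∑ k ∈ Finset.range n, η k) ω ∂P = 0 := by
    simp only [Finset.sum_apply]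
    rw [integral_finsetSum _ fun i _ => (hL i).integrable one_le_two]
    exact Finset.sum_eq_zero fun k _ => h0 k
  rw [variance_of_integral_eq_zero hm hz] at h1
  simpa [hvar, Finset.sum_apply] using h1

/-- **Kolmogorov's convergence criterion**: a series of independent centered random variables with
bounded partial sums of variances converges almost surely. -/
theorem ae_exists_tendsto_sum_of_iIndepFun (hm : ∀ n, Measurable (η n))
    (hL : ∀ n, MemLp (η n) 2 P) (hind : iIndepFun η P) (h0 : ∀ n, ∫ ω, η n ω ∂P = 0) {R : ℝ}
    (hR : ∀ n, ∑ k ∈ Finset.range n, ∫ ω, η k ω ^ 2 ∂P ≤ R) :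
    ∀ᵐ ω ∂P, ∃ c, Tendsto (fun n => ∑ k ∈ Finset.range n, η k ω) atTop (𝓝 c) := by
  have hsm : ∀ n, StronglyMeasurable (η n) := fun n => (hm n).stronglyMeasurable
  have hint : ∀ n, Integrable (η n) P := fun n => (hL n).integrable one_le_two
  set ℱ := Filtration.natural η hsm with hℱ
  -- The sum includes the term `n`, matching the natural filtration at time `n`.
  set S : ℕ → Ω → ℝ := fun n ω => ∑ k ∈ Finset.range (n + 1), η k ω with hS
  have hSint : ∀ n, Integrable (S n) P := fun n =>
    integrable_finsetSum _ fun k _ => hint k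
  have hadapt : StronglyAdapted ℱ S := by
    intro n
    refine Finset.stronglyMeasurable_fun_sum _ fun k hk => ?_
    exact (Filtration.stronglyAdapted_natural hsm k).mono
      (ℱ.mono (Nat.lt_succ_iff.1 (Finset.mem_range.1 hk)))
  have hmart : Martingale S ℱ P := by
    refine martingale_nat hadapt hSint fun n => ?_
    have e : S (n + 1) = S n + η (n + 1) := by
      ext ω
      simp [hS, Finset.sum_range_succ]
    have h1 : P[S n + η (n + 1) | ℱ n] =ᵐ[P] P[S n | ℱ n] + P[η (n + 1) | ℱ n] :=
      condExp_add (hSint n) (hint _) _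
    have h2 : P[S n | ℱ n] = S n := condExp_of_stronglyMeasurable (ℱ.le n) (hadapt n) (hSint n)
    have h3 := hind.condExp_natural_ae_eq_of_lt hsm (Nat.lt_succ_self n)
    rw [e]
    filter_upwards [h1, h3] with ω h1 h3
    rw [h1, Pi.add_apply, h2]
    have : P[η (n + 1) | ℱ n] ω = 0 := by
      rw [← h0 (n + 1)]; exact h3
    rw [this, add_zero]
  have hL2 : ∀ n, MemLp (S n) 2 P := fun n => by
    have := memLp_finsetSum' (Finset.range (n + 1)) fun i _ => hL i
    convert this using 1
    ext ω
    simp [hS]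
  -- Since `|x| ≤ 1 + x ^ 2`, the bound on the variances is a bound in `L¹`, as martingale
  -- convergence requires.
  have hbdd : ∀ n, eLpNorm (S n) 1 P ≤ ((1 + R).toNNReal : ENNReal) := by
    intro n
    rw [eLpNorm_one_eq_lintegral_enorm, ← ofReal_integral_norm_eq_lintegral_enorm (hSint n)]
    refine ENNReal.ofReal_le_ofReal ?_
    calc ∫ ω, ‖S n ω‖ ∂P ≤ ∫ ω, (1 + S n ω ^ 2) ∂P := by
          refine integral_mono (hSint n).norm ((integrable_const 1).add (hL2 n).integrable_sq)
            fun ω => ?_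
          rw [Real.norm_eq_abs]
          show |S n ω| ≤ 1 + S n ω ^ 2
          nlinarith [sq_nonneg (|S n ω| - 1), sq_abs (S n ω), abs_nonneg (S n ω)]
      _ = 1 + ∫ ω, S n ω ^ 2 ∂P := by
          rw [integral_add (integrable_const 1) (hL2 n).integrable_sq]
          simp
      _ ≤ 1 + R := by
          have := integral_sq_sum_of_iIndepFun hL hind h0 (n + 1)
          simp only [hS]
          rw [this]
          linarith [hR (n + 1)]
  filter_upwards [hmart.submartingale.exists_ae_tendsto_of_bdd hbdd] with ω ⟨c, hc⟩
  exact ⟨c, (tendsto_add_atTop_iff_nat 1).1 hc⟩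

end Sums

/-- **Kronecker's lemma**, with the partial sums of a nonnegative sequence as weights. -/
lemma tendsto_sum_div_zero_of_tendsto_sum_div {p x : ℕ → ℝ} (hp : ∀ k, 0 ≤ p k) (hp0 : 0 < p 0)
    (hE : Tendsto (fun n => ∑ k ∈ Finset.range n, p k) atTop atTop) {t : ℝ}
    (h : Tendsto (fun n => ∑ k ∈ Finset.range n, x k / ∑ j ∈ Finset.range (k + 1), p j) atTop
      (𝓝 t)) :
    Tendsto (fun n => (∑ k ∈ Finset.range n, x k) / ∑ k ∈ Finset.range n, p k) atTop (𝓝 0) := by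
  set E : ℕ → ℝ := fun n => ∑ k ∈ Finset.range n, p k with hEdef
  set D : ℕ → ℝ := fun n => (∑ k ∈ Finset.range n, x k / E (k + 1)) - t with hD
  have hEpos : ∀ k, 0 < E (k + 1) := fun k =>
    hp0.trans_le (Finset.single_le_sum (f := p) (fun i _ => hp i) (by simp))
  have hD0 : Tendsto D atTop (𝓝 0) := by simpa [hD] using h.sub_const t
  -- Summation by parts: after division by `E n` there remain the null sequence `D` and its weighted
  -- means with the divergent weights `p`.
  have hsum : ∀ n, ∑ k ∈ Finset.range n, x k = E n * D n - ∑ k ∈ Finset.range n, p k * D k := by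
    intro n
    induction n with
    | zero => simp [hEdef]
    | succ n ih =>
      have e1 : D (n + 1) = D n + x n / E (n + 1) := by
        simp only [hD, Finset.sum_range_succ]
        ring
      have e2 : E (n + 1) = E n + p n := Finset.sum_range_succ _ _
      have e3 : x n = E (n + 1) * (x n / E (n + 1)) := by
        field_simp [(hEpos n).ne']
      rw [Finset.sum_range_succ, Finset.sum_range_succ _ n, ih, e1]
      have : E (n + 1) * (D n + x n / E (n + 1)) = E n * D n + p n * D n + x n := by
        rw [mul_add, ← e3, e2]
        ring
      rw [this]
      ring
  have hlo : (fun k => p k * D k) =o[atTop] p := by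
    have h1 : D =o[atTop] fun _ => (1 : ℝ) := (Asymptotics.isLittleO_one_iff ℝ).2 hD0
    simpa using (Asymptotics.isBigO_refl p atTop).mul_isLittleO h1
  have h2 := (hlo.sum_range hp hE).tendsto_div_nhds_zero
  have h3 := hD0.sub h2
  rw [sub_zero] at h3
  refine h3.congr' ?_
  filter_upwards [hE.eventually_gt_atTop 0] with n hn
  rw [hsum n, sub_div, mul_div_cancel_left₀ _ hn.ne']

/-- Each term after the first is at most the increment `1 / E k - 1 / E (k + 1)`. The first term and
the telescoping sum each contribute at most `1 / p 0`. -/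
lemma sum_div_sq_partialSum_le {p : ℕ → ℝ} (hp : ∀ k, 0 ≤ p k) (hp0 : 0 < p 0) (n : ℕ) :
    ∑ k ∈ Finset.range n, p k / (∑ j ∈ Finset.range (k + 1), p j) ^ 2 ≤ 2 / p 0 := by
  set E : ℕ → ℝ := fun n => ∑ k ∈ Finset.range n, p k with hEdef
  have hEpos : ∀ k, 0 < E (k + 1) := fun k =>
    hp0.trans_le (Finset.single_le_sum (f := p) (fun i _ => hp i) (by simp))
  have key : ∀ n, ∑ k ∈ Finset.range (n + 1), p k / E (k + 1) ^ 2 ≤ 2 / p 0 - 1 / E (n + 1) := by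
    intro n
    induction n with
    | zero =>
      have : E 1 = p 0 := by simp [hEdef]
      rw [Finset.sum_range_one, zero_add, this]
      apply le_of_eq
      field_simp
      norm_num
    | succ n ih =>
      rw [Finset.sum_range_succ]
      have e2 : E (n + 1 + 1) = E (n + 1) + p (n + 1) := Finset.sum_range_succ _ _
      have h1 : p (n + 1) / E (n + 1 + 1) ^ 2 ≤ 1 / E (n + 1) - 1 / E (n + 1 + 1) := by
        have ha := hEpos n
        have hb := hEpos (n + 1)
        have hle : E (n + 1) ≤ E (n + 1 + 1) := by rw [e2]; linarith [hp (n + 1)]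
        rw [div_sub_div _ _ ha.ne' hb.ne', one_mul, mul_one]
        have : p (n + 1) = E (n + 1 + 1) - E (n + 1) := by rw [e2]; ring
        rw [this]
        refine div_le_div_of_nonneg_left (sub_nonneg.2 hle) (by positivity) ?_
        nlinarith
      linarith
  cases n with
  | zero => simp; positivity
  | succ n =>
    refine (key n).trans ?_
    have := hEpos n
    have : 0 ≤ 1 / E (n + 1) := by positivity
    linarith

/-! ### Strong law and central limit theorem for bounded independent variables -/

/-- The factors are exchanged one at a time, the others having norm at most one. -/
lemma norm_prod_sub_prod_le {ι : Type*} (s : Finset ι) (a b : ι → ℂ) (ha : ∀ i, ‖a i‖ ≤ 1)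
    (hb : ∀ i, ‖b i‖ ≤ 1) : ‖∏ i ∈ s, a i - ∏ i ∈ s, b i‖ ≤ ∑ i ∈ s, ‖a i - b i‖ := by
  classical
  induction s using Finset.induction_on with
  | empty => simp
  | insert i s hi ih =>
    rw [Finset.prod_insert hi, Finset.prod_insert hi, Finset.sum_insert hi]
    have e : a i * ∏ j ∈ s, a j - b i * ∏ j ∈ s, b j =
        (a i - b i) * ∏ j ∈ s, a j + b i * (∏ j ∈ s, a j - ∏ j ∈ s, b j) := by ring
    have h1 : ‖∏ j ∈ s, a j‖ ≤ 1 := by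
      rw [norm_prod]
      exact Finset.prod_le_one (fun j _ => norm_nonneg _) fun j _ => ha j
    rw [e]
    refine (norm_add_le _ _).trans ?_
    rw [norm_mul, norm_mul]
    refine add_le_add (mul_le_of_le_one_right (norm_nonneg _) h1) ?_
    exact (mul_le_of_le_one_left (norm_nonneg _) (hb i)).trans ih

lemma norm_cexp_mul_I_sub_taylor_le {x : ℝ} (hx : |x| ≤ 1) :
    ‖Complex.exp (x * Complex.I) - (1 + x * Complex.I - (x ^ 2 / 2 : ℝ))‖ ≤ |x| ^ 3 := by
  have hn : ‖(x * Complex.I : ℂ)‖ = |x| := by simp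
  have h := Complex.exp_bound (x := x * Complex.I) (by rw [hn]; exact hx) (n := 3) (by norm_num)
  rw [hn] at h
  have e : ∑ m ∈ Finset.range 3, (x * Complex.I : ℂ) ^ m / (m.factorial : ℂ) =
      1 + x * Complex.I - (x ^ 2 / 2 : ℝ) := by
    simp only [Finset.sum_range_succ, Finset.sum_range_zero, Nat.factorial]
    push_cast
    linear_combination (x ^ 2 / 2 : ℂ) * Complex.I_sq
  rw [e] at h
  refine h.trans (mul_le_of_le_one_right (by positivity) ?_)
  norm_num [Nat.factorial]

lemma abs_exp_neg_sub_one_add_le {y : ℝ} (h0 : 0 ≤ y) (h1 : y ≤ 1) :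
    |Real.exp (-y) - (1 - y)| ≤ y ^ 2 := by
  have := Real.abs_exp_sub_one_sub_id_le (x := -y) (by rw [abs_neg, abs_of_nonneg h0]; exact h1)
  rw [neg_sq] at this
  convert this using 2
  ring

section CLT

variable {Ω : Type*} [MeasurableSpace Ω] {P : Measure Ω} [IsProbabilityMeasure P]

/-- Second order expansion of the characteristic function of a centered variable bounded by `1`. -/
lemma norm_charFun_sub_exp_le {η : Ω → ℝ} (hm : Measurable η) (hb : ∀ ω, |η ω| ≤ 1)
    (h0 : ∫ ω, η ω ∂P = 0) {u : ℝ} (hu : |u| ≤ 1) :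
    ‖charFun (P.map η) u - Complex.exp (-(∫ ω, η ω ^ 2 ∂P) * u ^ 2 / 2 : ℝ)‖ ≤
      2 * |u| ^ 3 * ∫ ω, η ω ^ 2 ∂P := by
  set v := ∫ ω, η ω ^ 2 ∂P with hv
  have hi1 : Integrable η P := Integrable.of_bound hm.aestronglyMeasurable 1 (ae_of_all _ hb)
  have hsq : ∀ ω, η ω ^ 2 ≤ 1 := fun ω => by rw [← sq_abs]; exact pow_le_one₀ (abs_nonneg _) (hb ω)
  have hi2 : Integrable (fun ω => η ω ^ 2) P :=
    Integrable.of_bound (hm.pow_const 2).aestronglyMeasurable 1 (ae_of_all _ fun ω => by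
      rw [Real.norm_eq_abs, abs_of_nonneg (sq_nonneg _)]; exact hsq ω)
  have hv0 : 0 ≤ v := integral_nonneg fun ω => sq_nonneg _
  have hv1 : v ≤ 1 := by
    calc v ≤ ∫ _, (1 : ℝ) ∂P := integral_mono hi2 (integrable_const 1) hsq
      _ = 1 := by simp
  have hchar : charFun (P.map η) u = ∫ ω, Complex.exp ((u * η ω : ℝ) * Complex.I) ∂P := by
    rw [charFun_apply_real, integral_map hm.aemeasurable (by fun_prop)]
    simp
  have hie : Integrable (fun ω => Complex.exp ((u * η ω : ℝ) * Complex.I)) P := by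
    refine Integrable.of_bound (by fun_prop) 1 (ae_of_all _ fun ω => ?_)
    rw [Complex.norm_exp_ofReal_mul_I]
  have hiq : Integrable (fun ω => (1 + (u * η ω : ℝ) * Complex.I - ((u * η ω) ^ 2 / 2 : ℝ) : ℂ))
      P := by
    refine ((integrable_const 1).add ((hi1.const_mul u).ofReal.mul_const _)).sub ?_
    have : Integrable (fun ω => (u * η ω) ^ 2 / 2) P := by
      simpa [mul_pow] using (hi2.const_mul (u ^ 2)).div_const 2
    exact this.ofReal
  have hq : ∫ ω, (1 + (u * η ω : ℝ) * Complex.I - ((u * η ω) ^ 2 / 2 : ℝ) : ℂ) ∂P =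
      (1 - v * u ^ 2 / 2 : ℝ) := by
    have i1 : Integrable (fun ω => ((u * η ω : ℝ) : ℂ) * Complex.I) P :=
      (hi1.const_mul u).ofReal.mul_const _
    have i2 : Integrable (fun ω => (u * η ω) ^ 2 / 2) P := by
      simpa [mul_pow] using (hi2.const_mul (u ^ 2)).div_const 2
    have i3 : Integrable (fun ω => (1 : ℂ) + ((u * η ω : ℝ) : ℂ) * Complex.I) P :=
      (integrable_const 1).add i1
    have i4 : Integrable (fun ω => (((u * η ω) ^ 2 / 2 : ℝ) : ℂ)) P := i2.ofReal
    have e1 : ∫ ω, ((u * η ω : ℝ) : ℂ) ∂P = ((∫ ω, u * η ω ∂P : ℝ) : ℂ) := integral_ofReal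
    have e2 : ∫ ω, (((u * η ω) ^ 2 / 2 : ℝ) : ℂ) ∂P = ((∫ ω, (u * η ω) ^ 2 / 2 ∂P : ℝ) : ℂ) :=
      integral_ofReal
    rw [integral_sub i3 i4, integral_add (integrable_const 1) i1, integral_mul_const, e1, e2,
      integral_const_mul, h0, integral_div]
    simp only [mul_pow]
    rw [integral_const_mul, ← hv]
    simp
    ring
  -- Boundedness gives `|η| ^ 3 ≤ η ^ 2`, so the cubic error is charged to the variance and can
  -- later be summed.
  have h1 : ‖charFun (P.map η) u - (1 - v * u ^ 2 / 2 : ℝ)‖ ≤ |u| ^ 3 * v := by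
    rw [hchar, ← hq, ← integral_sub hie hiq]
    refine (norm_integral_le_integral_norm _).trans ?_
    rw [hv, ← integral_const_mul]
    refine integral_mono (hie.sub hiq).norm (hi2.const_mul _) fun ω => ?_
    have hx : |u * η ω| ≤ 1 := by
      rw [abs_mul]
      exact mul_le_one₀ hu (abs_nonneg _) (hb ω)
    refine (norm_cexp_mul_I_sub_taylor_le hx).trans ?_
    rw [abs_mul, mul_pow]
    refine mul_le_mul_of_nonneg_left ?_ (by positivity)
    rw [pow_succ, sq_abs]
    exact mul_le_of_le_one_right (sq_nonneg _) (hb ω)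
  have hu2 : u ^ 2 ≤ 1 := by rw [← sq_abs]; exact pow_le_one₀ (abs_nonneg _) hu
  have hy0 : 0 ≤ v * u ^ 2 / 2 := by positivity
  have hy1 : v * u ^ 2 / 2 ≤ 1 := by nlinarith [sq_nonneg u]
  have h2 := abs_exp_neg_sub_one_add_le hy0 hy1
  have h3 : ‖((1 - v * u ^ 2 / 2 : ℝ) : ℂ) - Complex.exp (-v * u ^ 2 / 2 : ℝ)‖ ≤ |u| ^ 3 * v := by
    rw [← Complex.ofReal_exp, ← Complex.ofReal_sub, Complex.norm_real, Real.norm_eq_abs,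
      abs_sub_comm]
    have e : -v * u ^ 2 / 2 = -(v * u ^ 2 / 2) := by ring
    rw [e]
    refine h2.trans ?_
    have hw0 := abs_nonneg u
    rw [← sq_abs u] at *
    set w := |u|
    have hw3 : w ^ 3 * v ≥ 0 := by positivity
    have : (v * w ^ 2 / 2) ^ 2 = (w ^ 3 * v) * (w * v / 4) := by ring
    rw [this]
    refine mul_le_of_le_one_right hw3 ?_
    nlinarith
  calc _ ≤ _ := norm_sub_le_norm_sub_add_norm_sub _ ((1 - v * u ^ 2 / 2 : ℝ) : ℂ) _
    _ ≤ |u| ^ 3 * v + |u| ^ 3 * v := add_le_add h1 h3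
    _ = 2 * |u| ^ 3 * v := by ring

/-- The **central limit theorem** for independent centered variables bounded by `1` whose sums have
variances tending to infinity. -/
theorem tendstoInDistribution_sum_div_sqrt {η : ℕ → Ω → ℝ} (hm : ∀ n, Measurable (η n))
    (hb : ∀ n ω, |η n ω| ≤ 1) (hind : iIndepFun η P) (h0 : ∀ n, ∫ ω, η n ω ∂P = 0) {V : ℕ → ℝ}
    (hV : ∀ n, V n = ∑ k ∈ Finset.range n, ∫ ω, η k ω ^ 2 ∂P) (hVt : Tendsto V atTop atTop) :
    TendstoInDistribution (fun n ω => (∑ k ∈ Finset.range n, η k ω) / √(V n)) atTop id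
      (fun _ => P) (gaussianReal 0 1) where
  forall_aemeasurable n :=
    ((Finset.measurable_sum _ fun k _ => hm k).div_const _).aemeasurable
  aemeasurable_limit := aemeasurable_id
  tendsto := by
    refine ProbabilityMeasure.tendsto_iff_tendsto_charFun.2 fun t => ?_
    have hgauss : charFun (Measure.map id (gaussianReal 0 1)) t =
        Complex.exp (-t ^ 2 / 2 : ℝ) := by
      rw [Measure.map_id, charFun_gaussianReal]
      congr 1
      push_cast
      simp
      ring
    have hprod : ∀ n, charFun (P.map fun ω => (∑ k ∈ Finset.range n, η k ω) / √(V n)) t =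
        ∏ k ∈ Finset.range n, charFun (P.map (η k)) ((√(V n))⁻¹ * t) := by
      intro n
      have e : (fun ω => (∑ k ∈ Finset.range n, η k ω) / √(V n)) =
          fun ω => (√(V n))⁻¹ * ∑ k ∈ Finset.range n, η k ω := by
        ext ω
        rw [div_eq_inv_mul]
      rw [e, charFun_map_mul_comp, (hind.restrict _).charFun_map_fun_finsetSum_eq_prod
        (fun k _ => (hm k).aemeasurable), Finset.prod_apply]
      exact Finset.aemeasurable_fun_sum _ fun k _ => (hm k).aemeasurable
    have hsqrt : Tendsto (fun n => √(V n)) atTop atTop := Real.tendsto_sqrt_atTop.comp hVt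
    have hu0 : Tendsto (fun n => (√(V n))⁻¹ * t) atTop (𝓝 0) := by
      simpa using hsqrt.inv_tendsto_atTop.mul_const t
    have hlim : Tendsto (fun n => 2 * |t| ^ 2 * |(√(V n))⁻¹ * t|) atTop (𝓝 0) := by
      have := (hu0.abs).const_mul (2 * |t| ^ 2)
      rwa [abs_zero, mul_zero] at this
    have hev : ∀ᶠ n in atTop, ‖charFun (P.map fun ω =>
        (∑ k ∈ Finset.range n, η k ω) / √(V n)) t - Complex.exp (-t ^ 2 / 2 : ℝ)‖ ≤
          2 * |t| ^ 2 * |(√(V n))⁻¹ * t| := by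
      have hsmall : ∀ᶠ n in atTop, |(√(V n))⁻¹ * t| ≤ 1 := by
        have := (hu0.abs).eventually_le_const (show |(0 : ℝ)| < 1 by simp)
        exact this
      filter_upwards [hsmall, hVt.eventually_gt_atTop 0] with n hn hVn
      set u := (√(V n))⁻¹ * t with hu
      have hu2 : V n * u ^ 2 = t ^ 2 := by
        rw [hu, mul_pow, inv_pow, Real.sq_sqrt hVn.le]
        field_simp
      -- The Gaussian limit is split in proportion to the variances, to be compared factor by
      -- factor.
      have hexp : Complex.exp (-t ^ 2 / 2 : ℝ) = ∏ k ∈ Finset.range n,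
          Complex.exp (-(∫ ω, η k ω ^ 2 ∂P) * u ^ 2 / 2 : ℝ) := by
        rw [← Complex.exp_sum, ← Complex.ofReal_sum, ← Finset.sum_div, ← Finset.sum_mul,
          Finset.sum_neg_distrib, ← hV n, neg_mul, hu2]
      rw [hprod n, hexp]
      refine (norm_prod_sub_prod_le _ _ _ (fun k => ?_) fun k => ?_).trans ?_
      · have := Measure.isProbabilityMeasure_map (μ := P) (hm k).aemeasurable
        exact norm_charFun_le_one _
      · rw [← Complex.ofReal_exp, Complex.norm_real, Real.norm_eq_abs, abs_of_pos (Real.exp_pos _)]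
        refine Real.exp_le_one_iff.2 ?_
        have : 0 ≤ ∫ ω, η k ω ^ 2 ∂P := integral_nonneg fun ω => sq_nonneg _
        have : 0 ≤ (∫ ω, η k ω ^ 2 ∂P) * u ^ 2 := by positivity
        linarith
      -- The errors add up to `2 * |u| ^ 3 * V n`, and `V n * u ^ 2 = t ^ 2` leaves one vanishing
      -- factor `|u|`.
      · refine (Finset.sum_le_sum fun k _ => norm_charFun_sub_exp_le (hm k) (hb k) (h0 k) hn).trans ?_
        rw [← Finset.mul_sum, ← hV n]
        apply le_of_eq
        have : |u| ^ 3 = |u| ^ 2 * |u| := pow_succ _ _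
        rw [this, sq_abs, sq_abs, ← hu2]
        ring
    have := squeeze_zero_norm' hev hlim
    rw [tendsto_sub_nhds_zero_iff] at this
    rw [← hgauss] at this
    exact this

/-- The **strong law of large numbers** for independent variables with values in `[0, 1]` whose
means have a divergent sum. -/
theorem ae_tendsto_sum_sub_div {ξ : ℕ → Ω → ℝ} (hm : ∀ n, Measurable (ξ n))
    (h01 : ∀ n ω, ξ n ω ∈ Set.Icc (0 : ℝ) 1) (hind : iIndepFun ξ P) {p : ℕ → ℝ}
    (hp : ∀ n, ∫ ω, ξ n ω ∂P = p n) (hp0 : 0 < p 0)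
    (hE : Tendsto (fun n => ∑ k ∈ Finset.range n, p k) atTop atTop) :
    ∀ᵐ ω ∂P, Tendsto (fun n => (∑ k ∈ Finset.range n, (ξ k ω - p k)) /
      ∑ k ∈ Finset.range n, p k) atTop (𝓝 0) := by
  have hint : ∀ n, Integrable (ξ n) P := fun n =>
    Integrable.of_bound (hm n).aestronglyMeasurable 1 (ae_of_all _ fun ω => by
      rw [Real.norm_eq_abs, abs_of_nonneg (h01 n ω).1]; exact (h01 n ω).2)
  have hpn : ∀ n, 0 ≤ p n := fun n => by
    rw [← hp]; exact integral_nonneg fun ω => (h01 n ω).1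
  have hL : ∀ n, MemLp (fun ω => ξ n ω - p n) 2 P := fun n =>
    MemLp.of_bound ((hm n).sub_const _).aestronglyMeasurable (1 + p n) (ae_of_all _ fun ω => by
      have h1 := h01 n ω
      have h2 := hpn n
      rw [Real.norm_eq_abs, abs_le]
      constructor <;> linarith [h1.1, h1.2])
  set E : ℕ → ℝ := fun n => ∑ k ∈ Finset.range n, p k with hEdef
  -- On `[0, 1]` the square is at most the variable itself, so the variance is at most the mean.
  have hsq : ∀ n, ∫ ω, (ξ n ω - p n) ^ 2 ∂P ≤ p n := by
    intro n
    have i2 : Integrable (fun ω => ξ n ω + (p n ^ 2 - 2 * p n * ξ n ω)) P :=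
      (hint n).add ((integrable_const _).sub ((hint n).const_mul _))
    have h1 : ∫ ω, (ξ n ω - p n) ^ 2 ∂P ≤ ∫ ω, (ξ n ω + (p n ^ 2 - 2 * p n * ξ n ω)) ∂P := by
      refine integral_mono (hL n).integrable_sq i2 fun ω => ?_
      show (ξ n ω - p n) ^ 2 ≤ ξ n ω + (p n ^ 2 - 2 * p n * ξ n ω)
      have := h01 n ω
      nlinarith [this.1, this.2]
    have i3 : Integrable (fun ω => p n ^ 2 - 2 * p n * ξ n ω) P :=
      (integrable_const _).sub ((hint n).const_mul _)
    rw [integral_add (hint n) i3, integral_sub (integrable_const _) ((hint n).const_mul _), integral_const_mul, hp] at h1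
    simp only [integral_const, probReal_univ, one_smul] at h1
    nlinarith [sq_nonneg (p n)]
  have hconv := ae_exists_tendsto_sum_of_iIndepFun (P := P)
    (η := fun n ω => (ξ n ω - p n) / E (n + 1)) (R := 2 / p 0)
    (fun n => ((hm n).sub_const _).div_const _) (fun n => ?_)
    (hind.comp (fun n x => (x - p n) / E (n + 1)) fun n =>
      (measurable_id.sub_const _).div_const _) (fun n => ?_) (fun n => ?_)
  · filter_upwards [hconv] with ω ⟨c, hc⟩
    exact tendsto_sum_div_zero_of_tendsto_sum_div hpn hp0 hE hc
  · simpa [div_eq_inv_mul] using (hL n).const_mul (E (n + 1))⁻¹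
  · rw [integral_div, integral_sub (hint n) (integrable_const _), hp]
    simp
  · refine le_trans (Finset.sum_le_sum fun k _ => ?_) (sum_div_sq_partialSum_le hpn hp0 n)
    simp only [div_pow]
    rw [integral_div]
    exact div_le_div_of_nonneg_right (hsq k) (sq_nonneg _)

end CLT

/-! ### Couplings -/

/-- **Maximal coupling** of two laws. -/
theorem exists_maximal_coupling (μ ν : Measure ℝ) [IsProbabilityMeasure μ]
    [IsProbabilityMeasure ν] :
    ∃ γ : Measure (ℝ × ℝ), γ.map Prod.fst = μ ∧ γ.map Prod.snd = ν ∧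
      ∃ D, MeasurableSet D ∧ γ {z | z.1 ≠ z.2} + ν D ≤ μ D := by
  set lam := μ + ν with hlam
  set f := μ.rnDeriv lam with hf
  set g := ν.rnDeriv lam with hg
  have hfm : Measurable f := Measure.measurable_rnDeriv _ _
  have hgm : Measurable g := Measure.measurable_rnDeriv _ _
  have hμf : lam.withDensity f = μ :=
    Measure.withDensity_rnDeriv_eq _ _ 
      (Measure.absolutelyContinuous_of_le (Measure.le_add_right le_rfl))
  have hνg : lam.withDensity g = ν :=
    Measure.withDensity_rnDeriv_eq _ _ 
      (Measure.absolutelyContinuous_of_le (Measure.le_add_left le_rfl))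
  -- The common part `κ` is placed on the diagonal; the excesses `ρ₁`, `ρ₂` have equal mass `r` and
  -- are coupled by their normalized product.
  set κ := lam.withDensity (f ⊓ g) with hκ
  set ρ₁ := lam.withDensity (f - g) with hρ₁
  set ρ₂ := lam.withDensity (g - f) with hρ₂
  have hμ : κ + ρ₁ = μ := by
    rw [hκ, hρ₁, ← withDensity_add_left (hfm.inf hgm), ← hμf]
    congr 1
    ext x
    simp only [Pi.add_apply, Pi.inf_apply, Pi.sub_apply]
    rcases le_total (f x) (g x) with h | h
    · rw [inf_eq_left.2 h, tsub_eq_zero_of_le h, add_zero]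
    · rw [inf_eq_right.2 h, add_tsub_cancel_of_le h]
  have hν : κ + ρ₂ = ν := by
    rw [hκ, hρ₂, ← withDensity_add_left (hfm.inf hgm), ← hνg]
    congr 1
    ext x
    simp only [Pi.add_apply, Pi.inf_apply, Pi.sub_apply]
    rcases le_total (f x) (g x) with h | h
    · rw [inf_eq_left.2 h, add_tsub_cancel_of_le h]
    · rw [inf_eq_right.2 h, tsub_eq_zero_of_le h, add_zero]
  have hκfin : IsFiniteMeasure κ := isFiniteMeasure_of_le μ (hμ ▸ Measure.le_add_right le_rfl)
  have hρ₁fin : IsFiniteMeasure ρ₁ := isFiniteMeasure_of_le μ (hμ ▸ Measure.le_add_left le_rfl)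
  have hρ₂fin : IsFiniteMeasure ρ₂ := isFiniteMeasure_of_le ν (hν ▸ Measure.le_add_left le_rfl)
  set r := ρ₁ Set.univ with hr
  have hr2 : ρ₂ Set.univ = r := by
    have h1 : κ Set.univ + ρ₁ Set.univ = 1 := by
      rw [← Measure.add_apply, hμ, measure_univ]
    have h2 : κ Set.univ + ρ₂ Set.univ = 1 := by
      rw [← Measure.add_apply, hν, measure_univ]
    exact (ENNReal.add_right_inj (measure_ne_top κ _)).1 (h2.trans h1.symm)
  have hrtop : r ≠ ⊤ := measure_ne_top ρ₁ _
  have hscale : ∀ ρ : Measure ℝ, ρ Set.univ = r → r⁻¹ • r • ρ = ρ := by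
    intro ρ hρ
    rw [smul_smul]
    -- For `r = 0` the factor `r⁻¹` is infinite, but it multiplies the zero measure.
    by_cases h0 : r = 0
    · rw [h0] at hρ
      rw [Measure.measure_univ_eq_zero.1 hρ, smul_zero]
    · rw [ENNReal.inv_mul_cancel h0 hrtop, one_smul]
  have hdiag : Measurable fun x : ℝ => (x, x) := by fun_prop
  refine ⟨κ.map (fun x => (x, x)) + r⁻¹ • ρ₁.prod ρ₂, ?_, ?_, {x | g x < f x},
    measurableSet_lt hgm hfm, ?_⟩
  · rw [Measure.map_add _ _ measurable_fst, Measure.map_map measurable_fst hdiag, Measure.map_smul,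
      Measure.map_fst_prod, hr2, hscale ρ₁ rfl]
    simpa [Function.comp_def] using hμ
  · rw [Measure.map_add _ _ measurable_snd, Measure.map_map measurable_snd hdiag, Measure.map_smul,
      Measure.map_snd_prod, ← hr, hscale ρ₂ hr2]
    simpa [Function.comp_def] using hν
  · set D := {x | g x < f x} with hD
    have hDm : MeasurableSet D := measurableSet_lt hgm hfm
    have hne : MeasurableSet {z : ℝ × ℝ | z.1 ≠ z.2} :=
      (measurableSet_eq_fun measurable_fst measurable_snd).compl
    have h1 : (κ.map (fun x => (x, x)) + r⁻¹ • ρ₁.prod ρ₂) {z | z.1 ≠ z.2} ≤ r := by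
      rw [Measure.add_apply, Measure.map_apply hdiag hne, Measure.smul_apply, smul_eq_mul]
      have e : (fun x : ℝ => (x, x)) ⁻¹' {z : ℝ × ℝ | z.1 ≠ z.2} = ∅ := by
        ext x
        simp
      rw [e, measure_empty, zero_add]
      calc r⁻¹ * ρ₁.prod ρ₂ {z | z.1 ≠ z.2} ≤ r⁻¹ * ρ₁.prod ρ₂ Set.univ := by
            gcongr
            exact Set.subset_univ _
        _ = r⁻¹ * (r * r) := by
            rw [← Set.univ_prod_univ, Measure.prod_prod, hr2]
        _ ≤ r := by
            rw [← mul_assoc]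
            exact mul_le_of_le_one_left zero_le (ENNReal.inv_mul_le_one r)
    -- The excess of `μ` lives on `D`, where the common part is `ν`; this gives `r + ν D = μ D`.
    have h2 : ρ₁ Dᶜ = 0 := by
      rw [hρ₁, withDensity_apply _ hDm.compl, setLIntegral_congr_fun hDm.compl (g := fun _ => 0)]
      · simp
      · intro x hx
        exact tsub_eq_zero_of_le (not_lt.1 hx)
    have h3 : r = ρ₁ D := by
      rw [hr, ← measure_add_measure_compl hDm, h2, add_zero]
    have h4 : κ D = ν D := by
      rw [← hνg, hκ, withDensity_apply _ hDm, withDensity_apply _ hDm]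
      refine setLIntegral_congr_fun hDm fun x hx => ?_
      exact inf_eq_right.2 (le_of_lt hx)
    calc _ ≤ r + ν D := by gcongr
      _ = κ D + ρ₁ D := by rw [h3, h4, add_comm]
      _ = μ D := by rw [← Measure.add_apply, hμ]

/-- Two product laws whose factors have couplings with summable probabilities of being different
can be realized by two sequences that eventually agree. -/
theorem exists_coupling_eventually_eq {μ ν : ℕ → Measure ℝ} [∀ n, IsProbabilityMeasure (μ n)]
    [∀ n, IsProbabilityMeasure (ν n)] {δ : ℕ → ENNReal} (hδ : ∑' n, δ n ≠ ⊤)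
    (hμν : ∀ n D, MeasurableSet D → μ n D ≤ ν n D + δ n) :
    ∃ Q : Measure (ℕ → ℝ × ℝ), IsProbabilityMeasure Q ∧
      Q.map (fun z n => (z n).1) = Measure.infinitePi μ ∧
      Q.map (fun z n => (z n).2) = Measure.infinitePi ν ∧
      ∀ᵐ z ∂Q, ∀ᶠ n in atTop, (z n).1 = (z n).2 := by
  choose γ hγ₁ hγ₂ D hDm hD using fun n => exists_maximal_coupling (μ n) (ν n)
  have hγ : ∀ n, IsProbabilityMeasure (γ n) := fun n => by
    constructor
    have : γ n (Prod.fst ⁻¹' Set.univ) = 1 := by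
      rw [← Measure.map_apply measurable_fst .univ, hγ₁, measure_univ]
    simpa using this
  refine ⟨Measure.infinitePi γ, inferInstance, ?_, ?_, ?_⟩
  · rw [Measure.infinitePi_map_pi γ (f := fun _ => Prod.fst) fun _ => measurable_fst]
    simp_rw [hγ₁]
  · rw [Measure.infinitePi_map_pi γ (f := fun _ => Prod.snd) fun _ => measurable_snd]
    simp_rw [hγ₂]
  · have hne : MeasurableSet {z : ℝ × ℝ | z.1 ≠ z.2} :=
      (measurableSet_eq_fun measurable_fst measurable_snd).compl
    have hle : ∀ n, Measure.infinitePi γ {z | (z n).1 ≠ (z n).2} ≤ δ n := by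
      intro n
      have e : Measure.infinitePi γ {z | (z n).1 ≠ (z n).2} = γ n {z | z.1 ≠ z.2} := by
        conv_rhs => rw [← Measure.infinitePi_map_eval γ n]
        rw [Measure.map_apply (measurable_pi_apply n) hne]
        rfl
      rw [e]
      -- On the set that witnesses maximality, the bound `δ n` becomes one on the probability of
      -- disagreement, ready for Borel–Cantelli.
      have h1 := (hD n).trans (hμν n (D n) (hDm n))
      rw [add_comm] at h1
      exact (ENNReal.add_le_add_iff_left (measure_ne_top _ _)).1 h1
    have hsum : ∑' n, Measure.infinitePi γ {z | (z n).1 ≠ (z n).2} ≠ ⊤ :=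
      ne_top_of_le_ne_top hδ (ENNReal.tsum_le_tsum hle)
    filter_upwards [ae_eventually_notMem hsum] with z hz
    exact hz.mono fun n hn => not_not.1 hn

/-- Truncating two laws from below makes their total variation distance at most the total variation
of their difference above the truncation level. -/
lemma map_sup_le_add_totalVariation (μ ν : Measure ℝ) [IsProbabilityMeasure μ]
    [IsProbabilityMeasure ν] (ℓ : ℝ) {D : Set ℝ} (hD : MeasurableSet D) :
    μ.map (fun x => x ⊔ ℓ) D ≤ ν.map (fun x => x ⊔ ℓ) D +
      (μ.toSignedMeasure - ν.toSignedMeasure).totalVariation (Set.Ioi ℓ) := by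
  have hm : Measurable fun x : ℝ => x ⊔ ℓ := measurable_id.sup_const ℓ
  rw [Measure.map_apply hm hD, Measure.map_apply hm hD]
  set s := μ.toSignedMeasure - ν.toSignedMeasure with hs
  have key : ∀ B, MeasurableSet B → B ⊆ Set.Ioi ℓ →
      |μ.real B - ν.real B| ≤ s.totalVariation.real (Set.Ioi ℓ) := by
    intro B hB hsub
    have h1 := s.norm_le_totalVariation B
    rw [hs, sub_apply, Measure.toSignedMeasure_apply_measurable hB,
      Measure.toSignedMeasure_apply_measurable hB, Real.norm_eq_abs] at h1
    exact h1.trans (measureReal_mono hsub)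
  suffices h : μ.real ((fun x => x ⊔ ℓ) ⁻¹' D) ≤ ν.real ((fun x => x ⊔ ℓ) ⁻¹' D) +
      s.totalVariation.real (Set.Ioi ℓ) by
    rw [← ofReal_measureReal (μ := μ), ← ofReal_measureReal (μ := ν),
      ← ofReal_measureReal (μ := s.totalVariation), ← ENNReal.ofReal_add (by positivity)
      (by positivity)]
    exact ENNReal.ofReal_le_ofReal h
  -- All mass at or below `ℓ` is moved to `ℓ`. Hence either the preimage of `D` or its complement
  -- lies above `ℓ`; in the second case total mass one is used.
  by_cases hℓ : ℓ ∈ D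
  · have e : (fun x => x ⊔ ℓ) ⁻¹' D = (Dᶜ ∩ Set.Ioi ℓ)ᶜ := by
      ext x
      simp only [Set.mem_preimage, Set.mem_compl_iff, Set.mem_inter_iff, Set.mem_Ioi, not_and,
        not_lt]
      rcases le_or_gt x ℓ with h | h
      · simp [hℓ, h]
      · simp [sup_eq_left.2 h.le, h.not_ge]
    have hB : MeasurableSet (Dᶜ ∩ Set.Ioi ℓ) := hD.compl.inter measurableSet_Ioi
    rw [e, probReal_compl_eq_one_sub hB, probReal_compl_eq_one_sub hB]
    have := abs_le.1 (key _ hB Set.inter_subset_right)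
    linarith [this.1]
  · have e : (fun x => x ⊔ ℓ) ⁻¹' D = D ∩ Set.Ioi ℓ := by
      ext x
      simp only [Set.mem_preimage, Set.mem_inter_iff, Set.mem_Ioi]
      rcases le_or_gt x ℓ with h | h
      · simp [hℓ, h]
      · simp [sup_eq_left.2 h.le, h]
    rw [e]
    have := abs_le.1 (key _ (hD.inter measurableSet_Ioi) Set.inter_subset_right)
    linarith [this.2]

/-- If, at and above a level, the conditional distribution function is the unconditional one, then
the variable truncated from below at the level is independent of the conditioning one. -/
lemma indepFun_sup_of_condCDF_eq {Ω β : Type*} [MeasurableSpace Ω] [MeasurableSpace β]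
    {P : Measure Ω} [IsProbabilityMeasure P] {X : Ω → β} {Y : Ω → ℝ} (hX : Measurable X)
    (hY : Measurable Y) {ℓ : ℝ}
    (h : ∀ᵐ y ∂(P.map X), ∀ x, ℓ ≤ x → cdf (condDistrib Y X P y) x = cdf (P.map Y) x) :
    IndepFun X (fun ω => Y ω ⊔ ℓ) P := by
  have hm : Measurable fun x : ℝ => x ⊔ ℓ := measurable_id.sup_const ℓ
  have hYprob : IsProbabilityMeasure (P.map Y) := Measure.isProbabilityMeasure_map hY.aemeasurable
  -- A truncated law has distribution function zero below `ℓ` and the original one from `ℓ` on, so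
  -- agreement there determines it.
  have hlaw : ∀ᵐ y ∂(P.map X), (condDistrib Y X P y).map (fun x => x ⊔ ℓ) =
      (P.map Y).map (fun x => x ⊔ ℓ) := by
    filter_upwards [h] with y hy
    have := Measure.isProbabilityMeasure_map (μ := condDistrib Y X P y) hm.aemeasurable
    refine Measure.ext_of_Iic _ _ fun x => ?_
    rw [Measure.map_apply hm measurableSet_Iic, Measure.map_apply hm measurableSet_Iic]
    rcases le_or_gt ℓ x with hx | hx
    · have e : (fun z => z ⊔ ℓ) ⁻¹' Set.Iic x = Set.Iic x := by
        ext z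
        simp [hx]
      rw [e, ← ofReal_cdf, ← ofReal_cdf, hy x hx]
    · have e : (fun z => z ⊔ ℓ) ⁻¹' Set.Iic x = ∅ := by
        ext z
        simp [hx]
      rw [e, measure_empty, measure_empty]
  rw [indepFun_iff_measure_inter_preimage_eq_mul]
  intro A B hA hB
  have e1 : P (X ⁻¹' A ∩ (fun ω => Y ω ⊔ ℓ) ⁻¹' B) =
      P.map (fun ω => (X ω, Y ω)) (A ×ˢ ((fun x => x ⊔ ℓ) ⁻¹' B)) := by
    rw [Measure.map_apply (hX.prodMk hY) (hA.prod (hm hB))]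
    rfl
  rw [e1, ← compProd_map_condDistrib hY.aemeasurable, Measure.compProd_apply_prod hA (hm hB)]
  have e2 : ∫⁻ a in A, condDistrib Y X P a ((fun x => x ⊔ ℓ) ⁻¹' B) ∂(P.map X) =
      ∫⁻ _ in A, P ((fun ω => Y ω ⊔ ℓ) ⁻¹' B) ∂(P.map X) := by
    refine lintegral_congr_ae (ae_restrict_of_ae ?_)
    filter_upwards [hlaw] with y hy
    have := congrArg (fun μ => μ B) hy
    simp only [Measure.map_apply hm hB, Measure.map_apply hY (hm hB)] at this
    exact this
  rw [e2, setLIntegral_const, Measure.map_apply hX hA, mul_comm]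

/-! ### The upper end point -/

lemma lt_one_of_lt_rightEnd {F : ℝ → ℝ} (hF : IsContinuousDF F) {x : ℝ}
    (hx : (x : EReal) < rightEnd F) : F x < 1 := by
  by_contra hcon
  rw [not_lt] at hcon
  refine absurd hx (not_lt.2 ?_)
  refine iSup₂_le fun u hu => ?_
  rw [EReal.coe_le_coe_iff]
  -- A point with `F z < u` is a lower bound, which makes the real infimum a genuine one.
  obtain ⟨z, hz⟩ := (hF.tendsto_atBot.eventually_lt_const hu.1).exists
  refine csInf_le ⟨z, fun y hy => ?_⟩ (hu.2.le.trans hcon)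
  by_contra hyz
  exact absurd (hF.monotone (not_le.1 hyz).le) (not_le.2 (hz.trans_le hy))

lemma one_le_of_rightEnd_lt {G : ℝ → ℝ} (hG : Monotone G) (hG1 : Tendsto G atTop (𝓝 1)) {x : ℝ}
    (hx : rightEnd G < (x : EReal)) : 1 ≤ G x := by
  refine le_of_forall_lt fun c hc => ?_
  obtain ⟨u, hu1, hu2⟩ := exists_between (max_lt hc (zero_lt_one' ℝ))
  have hu : u ∈ Set.Ioo (0 : ℝ) 1 := ⟨(le_max_right _ _).trans_lt hu1, hu2⟩
  have h1 : (genInv G u : EReal) ≤ rightEnd G :=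
    le_iSup₂ (f := fun u (_ : u ∈ Set.Ioo (0 : ℝ) 1) => (genInv G u : EReal)) u hu
  have h2 : genInv G u < x := EReal.coe_lt_coe_iff.1 (h1.trans_lt hx)
  obtain ⟨y, hy⟩ := (hG1.eventually_const_le hu.2).exists
  obtain ⟨z, hz, hzx⟩ := exists_lt_of_csInf_lt ⟨y, hy⟩ h2
  exact ((le_max_left _ _).trans_lt hu1).trans_le (le_trans hz (hG hzx.le))

section

variable {Ω : Type*} [MeasurableSpace Ω] {P : Measure Ω} [IsProbabilityMeasure P]

/-- Exceeding `b` means exceeding some rational above `b`, a countable union of null events. -/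
lemma ae_le_of_one_le_cdf {X : Ω → ℝ} (hX : Measurable X) {b : EReal}
    (h : ∀ x : ℝ, b < (x : EReal) → 1 ≤ cdf (P.map X) x) : ∀ᵐ ω ∂P, (X ω : EReal) ≤ b := by
  have : IsProbabilityMeasure (P.map X) := Measure.isProbabilityMeasure_map hX.aemeasurable
  have h1 : ∀ q : ℚ, ∀ᵐ ω ∂P, b < ((q : ℝ) : EReal) → X ω ≤ q := by
    intro q
    by_cases hq : b < ((q : ℝ) : EReal)
    · have h2 : cdf (P.map X) q = 1 := le_antisymm (cdf_le_one _ _) (h q hq)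
      have h3 : ∀ᵐ x ∂(P.map X), x ∈ Set.Iic (q : ℝ) := by
        change Set.Iic (q : ℝ) ∈ ae (P.map X)
        rw [mem_ae_iff, prob_compl_eq_zero_iff measurableSet_Iic, ← ofReal_cdf, h2,
          ENNReal.ofReal_one]
      filter_upwards [ae_of_ae_map hX.aemeasurable h3] with ω hω _
      exact hω
    · exact ae_of_all _ fun ω hω => absurd hω hq
  filter_upwards [ae_all_iff.2 h1] with ω hω
  by_contra hcon
  obtain ⟨q, hq1, hq2⟩ := EReal.lt_iff_exists_rat_btwn.1 (not_le.1 hcon)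
  have := hω q hq1
  exact absurd (EReal.coe_lt_coe_iff.1 hq2) (not_lt.2 this)

variable {F : ℝ → ℝ} {α : ℕ → ℝ} {Y : ℕ → Ω → ℝ}

lemma IsFAlphaScheme.ae_lt_rightEnd (hα : ∀ n, 0 < α n) (hF : IsContinuousDF F)
    (h : IsFAlphaScheme F α Y P) : ∀ᵐ ω ∂P, ∀ n, (Y n ω : EReal) < rightEnd F := by
  refine ae_all_iff.2 fun n => ?_
  have hY := h.measurable n
  have : IsProbabilityMeasure (P.map (Y n)) := Measure.isProbabilityMeasure_map hY.aemeasurable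
  have h1 : ∀ᵐ ω ∂P, (Y n ω : EReal) ≤ rightEnd F := by
    refine ae_le_of_one_le_cdf hY fun x hx => ?_
    rw [h.cdf_eq]
    exact Real.one_le_rpow (one_le_of_rightEnd_lt hF.monotone hF.tendsto_atTop hx) (hα n).le
  have hna : NullSingletonClass (P.map (Y n)) := by
    refine nullSingletonClass_of_continuous_cdf _ ?_
    rw [show (cdf (P.map (Y n)) : ℝ → ℝ) = fun x => F x ^ α n from funext (h.cdf_eq n)]
    exact hF.continuous_rpow (hα n)
  -- For an infinite end point `toReal` defaults to `0`; discarding that null event does no harm.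
  have h2 : ∀ᵐ ω ∂P, Y n ω ≠ (rightEnd F).toReal := by
    have : P.map (Y n) {(rightEnd F).toReal} = 0 := measure_singleton _
    rw [Measure.map_apply hY (measurableSet_singleton _)] at this
    exact measure_eq_zero_iff_ae_notMem.1 this
  filter_upwards [h1, h2] with ω h1 h2
  refine lt_of_le_of_ne h1 fun heq => h2 ?_
  rw [← heq, EReal.toReal_coe]

/-- The first `n` terms all stay below `q` with probability `F q ^ s_n`, which tends to zero since
`F q < 1` and `s_n → ∞`. -/
lemma IsFAlphaScheme.ae_exists_gt (hα : ∀ n, 0 < α n) (hs : Tendsto (weightSum α) atTop atTop)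
    (hF : IsContinuousDF F) (h : IsFAlphaScheme F α Y P) :
    ∀ᵐ ω ∂P, ∀ q : ℚ, ((q : ℝ) : EReal) < rightEnd F → ∃ n, (q : ℝ) < Y n ω := by
  refine ae_all_iff.2 fun q => ?_
  by_cases hq : ((q : ℝ) : EReal) < rightEnd F
  swap
  · exact ae_of_all _ fun ω hω => absurd hω hq
  have h1 := lt_one_of_lt_rightEnd hF hq
  have hle : ∀ n, P {ω | ∀ n, Y n ω ≤ q} ≤ ENNReal.ofReal (F q ^ weightSum α (n + 1)) := by
    intro n
    have hM := measurable_partialSups_comp h.measurable n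
    have := Measure.isProbabilityMeasure_map (μ := P) hM.aemeasurable
    rw [← cdf_partialSups hα hF h n, ofReal_cdf, Measure.map_apply hM measurableSet_Iic]
    exact measure_mono fun ω hω => partialSups_le _ _ _ fun j _ => hω j
  have hlim : Tendsto (fun n => ENNReal.ofReal (F q ^ weightSum α (n + 1))) atTop (𝓝 0) := by
    rw [← ENNReal.ofReal_zero]
    refine ENNReal.tendsto_ofReal ?_
    exact (tendsto_rpow_atTop_of_base_lt_one _ (by linarith [hF.nonneg q]) h1).comp
      (hs.comp (tendsto_add_atTop_nat 1))
  have hz : P {ω | ∀ n, Y n ω ≤ q} = 0 :=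
    le_antisymm (ge_of_tendsto hlim (Eventually.of_forall hle)) zero_le
  filter_upwards [measure_eq_zero_iff_ae_notMem.1 hz] with ω hω _
  by_contra hcon
  exact hω fun n => not_lt.1 fun hn => hcon ⟨n, hn⟩

end

/-! ### Comparison of a threshold scheme with an `F^α`-scheme -/

lemma ae_iff_of_map_eq {A B C : Type*} [MeasurableSpace A] [MeasurableSpace B] [MeasurableSpace C]
    {μ : Measure A} {ν : Measure B} {f : A → C} {g : B → C} (hf : Measurable f) (hg : Measurable g)
    (h : μ.map f = ν.map g) {p : C → Prop} (hp : MeasurableSet {c | p c}) :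
    (∀ᵐ a ∂μ, p (f a)) ↔ ∀ᵐ b ∂ν, p (g b) := by
  rw [← ae_map_iff hf.aemeasurable hp, h, ae_map_iff hg.aemeasurable hp]

lemma measurableSet_eventually_lt_partialSups (ℓ : ℕ → ℝ) :
    MeasurableSet {x : ℕ → ℝ | ∀ᶠ n in atTop, ℓ n < partialSups x n} := by
  have e : {x : ℕ → ℝ | ∀ᶠ n in atTop, ℓ n < partialSups x n} =
      ⋃ m : ℕ, ⋂ n : ℕ, ⋂ _ : m ≤ n, {x : ℕ → ℝ | ℓ n < partialSups x n} := by
    ext x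
    simp [eventually_atTop]
  rw [e]
  exact MeasurableSet.iUnion fun m => MeasurableSet.iInter fun n => MeasurableSet.iInter fun _ =>
    measurableSet_lt measurable_const (measurable_partialSups n)

section Threshold

variable {Ω Ω' : Type*} [MeasurableSpace Ω] [MeasurableSpace Ω'] {P : Measure Ω}
  [IsProbabilityMeasure P] {P' : Measure Ω'} [IsProbabilityMeasure P'] {F : ℝ → ℝ}
  {α ℓ : ℕ → ℝ} {X : ℕ → Ω → ℝ} {Y : ℕ → Ω' → ℝ}

lemma IsThresholdScheme.ae_lt_rightEnd (hX : IsThresholdScheme F α ℓ X P Y P') :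
    ∀ᵐ ω ∂P, ∀ n, (X n ω : EReal) < rightEnd F := by
  refine ae_all_iff.2 fun n => ?_
  have h1 : ∀ᵐ ω ∂P, (X n ω : EReal) ≤ rightEnd F :=
    ae_le_of_one_le_cdf (hX.measurable n) fun x hx =>
      one_le_of_rightEnd_lt (monotone_cdf _) (tendsto_cdf_atTop _) ((hX.rightEnd_le n).trans_lt hx)
  filter_upwards [h1, measure_eq_zero_iff_ae_notMem.1 (hX.no_atom n)] with ω h1 h2
  exact lt_of_le_of_ne h1 h2

/-- For a typical outcome, `ℓ k ≤ ℓ n` is exceeded by a maximum of terms below the end point. Hence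
truncation keeps both sequences below it. -/
lemma IsThresholdScheme.threshold_lt_rightEnd (hY : IsFAlphaScheme F α Y P')
    (hX : IsThresholdScheme F α ℓ X P Y P') (k : ℕ) : (ℓ k : EReal) < rightEnd F := by
  obtain ⟨ω, h1, h2⟩ := (hX.eventually_above.and
    (hY.ae_lt_rightEnd hX.alpha_pos hX.continuousDF)).exists
  obtain ⟨n, hn, hkn⟩ := (h1.and (eventually_ge_atTop k)).exists
  obtain ⟨j, -, hj⟩ := exists_partialSups_eq (fun j => Y j ω) n
  rw [hj] at hn
  exact (EReal.coe_lt_coe_iff.2 ((hX.threshold_monotone hkn).trans_lt hn)).trans (h2 j)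

lemma IsThresholdScheme.iIndepFun_sup (hX : IsThresholdScheme F α ℓ X P Y P') :
    iIndepFun (fun n ω => X n ω ⊔ ℓ n) P := by
  refine iIndepFun_of_indepFun_prefix fun n => ?_
  have hpast : Measurable fun ω (j : Fin n) => X j ω :=
    measurable_pi_lambda _ fun j => hX.measurable j
  rcases Nat.eq_zero_or_pos n with rfl | hn
  · exact (indepFun_const_left (fun _ : Fin 0 => (0 : ℝ)) _).congr (ae_of_all _ fun ω => by
      ext j; exact j.elim0) (ae_of_all _ fun _ => rfl)
  · have h1 := indepFun_sup_of_condCDF_eq hpast (hX.measurable n) (hX.condCDF_eq n hn)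
    have hφ : Measurable fun (x : Fin n → ℝ) (j : Fin n) => x j ⊔ ℓ j :=
      measurable_pi_lambda _ fun j => (measurable_pi_apply j).sup_const _
    exact h1.comp hφ measurable_id

/-- A threshold scheme and an `F^α`-scheme, truncated from below by the thresholds, have a coupling
under which their record counts eventually differ by a constant. -/
theorem IsThresholdScheme.exists_coupling (hY : IsFAlphaScheme F α Y P')
    (hX : IsThresholdScheme F α ℓ X P Y P') :
    (∀ᵐ ω ∂P, CountsTailEquiv (fun n => X n ω ⊔ ℓ n) fun n => X n ω) ∧
    (∀ᵐ ω ∂P', CountsTailEquiv (fun n => Y n ω ⊔ ℓ n) fun n => Y n ω) ∧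
    ∃ Q : Measure (ℕ → ℝ × ℝ), IsProbabilityMeasure Q ∧
      Q.map (fun z n => (z n).1) = P.map (fun ω n => X n ω ⊔ ℓ n) ∧
      Q.map (fun z n => (z n).2) = P'.map (fun ω n => Y n ω ⊔ ℓ n) ∧
      ∀ᵐ z ∂Q, CountsTailEquiv (fun n => (z n).1) fun n => (z n).2 := by
  have hXm := hX.measurable
  have hYm := hY.measurable
  have hZm : ∀ n, Measurable fun ω => X n ω ⊔ ℓ n := fun n => (hXm n).sup_const _
  have hWm : ∀ n, Measurable fun ω => Y n ω ⊔ ℓ n := fun n => (hYm n).sup_const _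
  have hZ' : Measurable fun ω n => X n ω ⊔ ℓ n := measurable_pi_lambda _ hZm
  have hW' : Measurable fun ω n => Y n ω ⊔ ℓ n := measurable_pi_lambda _ hWm
  have hu' : Measurable fun (z : ℕ → ℝ × ℝ) n => (z n).1 :=
    measurable_pi_lambda _ fun n => measurable_fst.comp (measurable_pi_apply n)
  have hw' : Measurable fun (z : ℕ → ℝ × ℝ) n => (z n).2 :=
    measurable_pi_lambda _ fun n => measurable_snd.comp (measurable_pi_apply n)
  have hWind : iIndepFun (fun n ω => Y n ω ⊔ ℓ n) P' :=
    hY.indep.comp (fun n x => x ⊔ ℓ n) fun n => measurable_id.sup_const _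
  have hZp : ∀ n, IsProbabilityMeasure (P.map fun ω => X n ω ⊔ ℓ n) := fun n =>
    Measure.isProbabilityMeasure_map (hZm n).aemeasurable
  have hWp : ∀ n, IsProbabilityMeasure (P'.map fun ω => Y n ω ⊔ ℓ n) := fun n =>
    Measure.isProbabilityMeasure_map (hWm n).aemeasurable
  obtain ⟨Q, hQ, hQ1, hQ2, hQe⟩ := exists_coupling_eventually_eq
    (μ := fun n => P.map fun ω => X n ω ⊔ ℓ n) (ν := fun n => P'.map fun ω => Y n ω ⊔ ℓ n)
    hX.tv_summable.ne (fun n D hD => by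
      have := Measure.isProbabilityMeasure_map (μ := P) (hXm n).aemeasurable
      have := Measure.isProbabilityMeasure_map (μ := P') (hYm n).aemeasurable
      have hm : Measurable fun x : ℝ => x ⊔ ℓ n := measurable_id.sup_const _
      have := map_sup_le_add_totalVariation (P.map (X n)) (P'.map (Y n)) (ℓ n) hD
      rwa [Measure.map_map hm (hXm n), Measure.map_map hm (hYm n)] at this)
  -- Independence of both truncated sequences identifies the product laws of the coupling with their
  -- joint laws.
  rw [← hX.iIndepFun_sup.map_fun_eq_infinitePi_map hZm] at hQ1
  rw [← hWind.map_fun_eq_infinitePi_map hWm] at hQ2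
  have hset : MeasurableSet {x : ℕ → ℝ | ∀ k, (x k : EReal) < rightEnd F} := by
    have e : {x : ℕ → ℝ | ∀ k, (x k : EReal) < rightEnd F} =
        ⋂ k, {x : ℕ → ℝ | (x k : EReal) < rightEnd F} := by
      ext x
      simp
    rw [e]
    exact MeasurableSet.iInter fun k => measurableSet_lt
      (measurable_coe_real_ereal.comp (measurable_pi_apply k)) measurable_const
  have hset' : MeasurableSet {x : ℕ → ℝ | ∀ q : ℚ, ((q : ℝ) : EReal) < rightEnd F →
      ∃ n, (q : ℝ) < x n} := by
    have e : {x : ℕ → ℝ | ∀ q : ℚ, ((q : ℝ) : EReal) < rightEnd F → ∃ n, (q : ℝ) < x n} =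
        ⋂ q : ℚ, ⋂ _ : ((q : ℝ) : EReal) < rightEnd F, ⋃ n, {x : ℕ → ℝ | (q : ℝ) < x n} := by
      ext x
      simp
    rw [e]
    exact MeasurableSet.iInter fun q => MeasurableSet.iInter fun _ => MeasurableSet.iUnion fun n =>
      measurableSet_lt measurable_const (measurable_pi_apply n)
  have hℓ := hX.threshold_lt_rightEnd hY
  have hsup : ∀ (x : ℝ) k, (x : EReal) < rightEnd F → ((x ⊔ ℓ k : ℝ) : EReal) < rightEnd F := by
    intro x k hx
    rcases le_total x (ℓ k) with h | h
    · rw [sup_eq_right.2 h]; exact hℓ k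
    · rw [sup_eq_left.2 h]; exact hx
  have hu1 : ∀ᵐ z ∂Q, ∀ k, ((z k).1 : EReal) < rightEnd F := by
    refine (ae_iff_of_map_eq hu' hZ' hQ1 hset).2 ?_
    filter_upwards [hX.ae_lt_rightEnd] with ω hω k
    exact hsup _ k (hω k)
  have hw1 : ∀ᵐ z ∂Q, ∀ k, ((z k).2 : EReal) < rightEnd F := by
    refine (ae_iff_of_map_eq hw' hW' hQ2 hset).2 ?_
    filter_upwards [hY.ae_lt_rightEnd hX.alpha_pos hX.continuousDF] with ω hω k
    exact hsup _ k (hω k)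
  have hw2 : ∀ᵐ z ∂Q, ∀ q : ℚ, ((q : ℝ) : EReal) < rightEnd F → ∃ n, (q : ℝ) < (z n).2 := by
    refine (ae_iff_of_map_eq hw' hW' hQ2 hset').2 ?_
    filter_upwards [hY.ae_exists_gt hX.alpha_pos hX.weightSum_tendsto hX.continuousDF] with ω hω q hq
    obtain ⟨n, hn⟩ := hω q hq
    exact ⟨n, lt_sup_of_lt_left hn⟩
  have hW3 : ∀ᵐ ω ∂P', ∀ᶠ n in atTop, ℓ n < partialSups (fun k => Y k ω ⊔ ℓ k) n := by
    filter_upwards [hX.eventually_above] with ω hω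
    filter_upwards [hω] with n hn
    exact hn.trans_le (partialSups_mono (fun k => le_sup_left) n)
  have hw3 := (ae_iff_of_map_eq hw' hW' hQ2 (measurableSet_eventually_lt_partialSups ℓ)).2 hW3
  have hmax : ∀ᵐ z ∂Q, ∀ᶠ n in atTop,
      partialSups (fun k => (z k).1) n = partialSups (fun k => (z k).2) n := by
    filter_upwards [hQe, hu1, hw1, hw2] with z h1 h2 h3 h4
    refine partialSups_eventually_eq h1 h2 h3 fun c hc => ?_
    obtain ⟨q, hq1, hq2⟩ := EReal.lt_iff_exists_rat_btwn.1 hc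
    obtain ⟨n, hn⟩ := h4 q hq2
    exact ⟨n, (EReal.coe_lt_coe_iff.1 hq1).trans hn⟩
  -- That maxima exceed the thresholds is assumed for `Y` alone; the equality of maxima passes it to
  -- the other marginal and so to `X`.
  have hu3 : ∀ᵐ z ∂Q, ∀ᶠ n in atTop, ℓ n < partialSups (fun k => (z k).1) n := by
    filter_upwards [hmax, hw3] with z h1 h2
    filter_upwards [h1, h2] with n h1 h2
    rwa [h1]
  have hZ3 := (ae_iff_of_map_eq hu' hZ' hQ1 (measurableSet_eventually_lt_partialSups ℓ)).1 hu3
  refine ⟨?_, ?_, Q, hQ, hQ1, hQ2, ?_⟩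
  · filter_upwards [hZ3] with ω hω
    exact countsTailEquiv_of_partialSups
      (partialSups_truncate_eventually_eq hX.threshold_monotone hω)
  · filter_upwards [hW3] with ω hω
    exact countsTailEquiv_of_partialSups
      (partialSups_truncate_eventually_eq hX.threshold_monotone hω)
  · filter_upwards [hmax] with z hz
    exact countsTailEquiv_of_partialSups hz

end Threshold

/-! ### Asymptotics of the mean number of records -/

section Asymptotics

variable {α : ℕ → ℝ}

lemma weightSum_ratio_mem (hα : ∀ n, 0 < α n) (k : ℕ) :
    0 < α k / weightSum α (k + 1) ∧ α k / weightSum α (k + 1) ≤ 1 := by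
  have h1 := weightSum_pos hα k
  refine ⟨div_pos (hα k) h1, (div_le_one h1).2 ?_⟩
  rw [weightSum_succ]
  have : 0 ≤ weightSum α k := Finset.sum_nonneg fun i _ => (hα i).le
  linarith

lemma weightSum_mono (hα : ∀ n, 0 < α n) : Monotone (weightSum α) :=
  monotone_nat_of_le_succ fun n => by rw [weightSum_succ]; linarith [hα n]

/-- The **Abel-Dini theorem**. -/
lemma tendsto_sum_div_weightSum (hα : ∀ n, 0 < α n) (hs : Tendsto (weightSum α) atTop atTop) :
    Tendsto (fun n => ∑ k ∈ Finset.range n, α k / weightSum α (k + 1)) atTop atTop := by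
  set E : ℕ → ℝ := fun n => ∑ k ∈ Finset.range n, α k / weightSum α (k + 1) with hE
  have hmono : Monotone E := monotone_nat_of_le_succ fun n => by
    simp only [hE, Finset.sum_range_succ]
    linarith [(weightSum_ratio_mem hα n).1]
  -- In a block the denominators are at most `s_m`, so it contributes at least one half once `s_m ≥
  -- 2 s_N`.
  have hblock : ∀ N m, N ≤ m → E N + (weightSum α m - weightSum α N) / weightSum α m ≤ E m := by
    intro N m hm
    have h1 : E m = E N + ∑ k ∈ Finset.Ico N m, α k / weightSum α (k + 1) :=
      (Finset.sum_range_add_sum_Ico _ hm).symm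
    have h2 : weightSum α m - weightSum α N = ∑ k ∈ Finset.Ico N m, α k := by
      rw [weightSum, weightSum, ← Finset.sum_range_add_sum_Ico _ hm]
      ring
    rw [h1, h2, Finset.sum_div]
    refine (add_le_add_iff_left _).2 (Finset.sum_le_sum fun k hk => ?_)
    exact div_le_div_of_nonneg_left (hα k).le (weightSum_pos hα k)
      (weightSum_mono hα (Finset.mem_Ico.1 hk).2)
  have hstep : ∀ N, ∃ m, E N + 1 / 2 ≤ E m := by
    intro N
    -- The added `1` keeps `s_m` positive when `N = 0`.
    obtain ⟨m, hm1, hm2⟩ := ((hs.eventually_ge_atTop (2 * weightSum α N + 1)).and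
      (eventually_ge_atTop N)).exists
    have hNn : 0 ≤ weightSum α N := Finset.sum_nonneg fun i _ => (hα i).le
    refine ⟨m, le_trans ((add_le_add_iff_left _).2 ?_) (hblock N m hm2)⟩
    rw [div_le_div_iff₀ (by norm_num) (by linarith)]
    linarith
  refine tendsto_atTop_atTop_of_monotone hmono fun b => ?_
  have hk : ∀ k : ℕ, ∃ m, (k : ℝ) / 2 ≤ E m := by
    intro k
    induction k with
    | zero => exact ⟨0, by simp [hE]⟩
    | succ k ih =>
      obtain ⟨m, hm⟩ := ih
      obtain ⟨m', hm'⟩ := hstep m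
      refine ⟨m', ?_⟩
      push_cast
      linarith
  obtain ⟨k, hk'⟩ := exists_nat_ge (2 * b)
  obtain ⟨m, hm⟩ := hk k
  exact ⟨m, by linarith⟩

/-- This is `1 - 1/x ≤ log x` at `x = s_{k+1}/s_k`; the case `k = 0` is excluded because `s_0 = 0`.
-/
lemma ratio_le_log_sub_log (hα : ∀ n, 0 < α n) {k : ℕ} (hk : 1 ≤ k) :
    α k / weightSum α (k + 1) ≤
      Real.log (weightSum α (k + 1)) - Real.log (weightSum α k) := by
  obtain ⟨j, rfl⟩ : ∃ j, k = j + 1 := ⟨k - 1, by omega⟩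
  have h1 := weightSum_pos hα j
  have h2 := weightSum_pos hα (j + 1)
  rw [← Real.log_div h2.ne' h1.ne']
  refine le_trans (le_of_eq ?_) (Real.one_sub_inv_le_log_of_pos (div_pos h2 h1))
  rw [inv_div, eq_sub_iff_add_eq, ← add_div, add_comm, ← weightSum_succ, div_self h2.ne']

lemma log_sub_log_le_ratio (hα : ∀ n, 0 < α n) {k : ℕ} (hk : 1 ≤ k) :
    Real.log (weightSum α (k + 1)) - Real.log (weightSum α k) ≤ α k / weightSum α k := by
  obtain ⟨j, rfl⟩ : ∃ j, k = j + 1 := ⟨k - 1, by omega⟩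
  have h1 := weightSum_pos hα j
  have h2 := weightSum_pos hα (j + 1)
  rw [← Real.log_div h2.ne' h1.ne']
  refine (Real.log_le_sub_one_of_pos (div_pos h2 h1)).trans (le_of_eq ?_)
  rw [sub_eq_iff_eq_add, weightSum_succ α (j + 1), add_div, div_self h1.ne', add_comm]

/-- The sum telescopes down to `log s_0`, which is `0` by the convention for `log 0`. -/
lemma sum_log_sub_log (α : ℕ → ℝ) (n : ℕ) : ∑ k ∈ Finset.range n,
    (Real.log (weightSum α (k + 1)) - Real.log (weightSum α k)) = Real.log (weightSum α n) := by
  rw [Finset.sum_range_sub fun k => Real.log (weightSum α k)]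
  simp [weightSum]

lemma sum_ratio_le_log_add (hα : ∀ n, 0 < α n) (n : ℕ) :
    ∑ k ∈ Finset.range (n + 1), α k / weightSum α (k + 1) ≤
      Real.log (weightSum α (n + 1)) + (1 - Real.log (α 0)) := by
  have e0 : weightSum α 1 = α 0 := by simp [weightSum]
  induction n with
  | zero => simp [e0, (hα 0).ne']
  | succ n ih =>
    rw [Finset.sum_range_succ]
    have := ratio_le_log_sub_log hα (k := n + 1) (by omega)
    linarith

lemma eventually_sum_ratio_le_two_mul_log (hα : ∀ n, 0 < α n)
    (hs : Tendsto (weightSum α) atTop atTop) :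
    ∀ᶠ n in atTop, ∑ k ∈ Finset.range n, α k / weightSum α (k + 1) ≤
      2 * Real.log (weightSum α n) := by
  filter_upwards [(Real.tendsto_log_atTop.comp hs).eventually_ge_atTop (1 - Real.log (α 0)),
    eventually_ge_atTop 1] with n h1 h2
  obtain ⟨m, rfl⟩ : ∃ m, n = m + 1 := ⟨n - 1, by omega⟩
  have := sum_ratio_le_log_add hα m
  simp only [Function.comp_apply] at h1
  linarith

/-- The logarithmic increments lie between `p` and `p / (1 - p)`, so they differ from `p` by `O(p²)
= o(p)`. Since the sum of the `p k` diverges, this passes to the sums. -/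
lemma tendsto_sum_ratio_div_log_one (hα : ∀ n, 0 < α n) (hs : Tendsto (weightSum α) atTop atTop)
    (hp : Tendsto (fun k => α k / weightSum α (k + 1)) atTop (𝓝 0)) :
    Tendsto (fun n => (∑ k ∈ Finset.range n, α k / weightSum α (k + 1)) /
      Real.log (weightSum α n)) atTop (𝓝 1) := by
  set p : ℕ → ℝ := fun k => α k / weightSum α (k + 1) with hpdef
  set E : ℕ → ℝ := fun n => ∑ k ∈ Finset.range n, p k with hE
  have hEt : Tendsto E atTop atTop := tendsto_sum_div_weightSum hα hs
  have hlo : (fun k => Real.log (weightSum α (k + 1)) - Real.log (weightSum α k) - p k) =o[atTop]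
      p := by
    have h1 : (fun k => 2 * p k * p k) =o[atTop] p := by
      have h2 : (fun k => 2 * p k) =o[atTop] fun _ => (1 : ℝ) :=
        (Asymptotics.isLittleO_one_iff ℝ).2 (by simpa using hp.const_mul 2)
      simpa using h2.mul_isBigO (Asymptotics.isBigO_refl p atTop)
    refine Asymptotics.IsBigO.trans_isLittleO (Asymptotics.IsBigO.of_bound 1 ?_) h1
    filter_upwards [hp.eventually_le_const (show (0 : ℝ) < 1 / 2 by norm_num),
      eventually_ge_atTop 1] with k hk1 hk2
    have hl := ratio_le_log_sub_log hα hk2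
    have hr := log_sub_log_le_ratio hα hk2
    have hp0 : 0 < p k := (weightSum_ratio_mem hα k).1
    have hS1 := weightSum_pos hα k
    have hS : 0 < weightSum α k := by
      obtain ⟨j, rfl⟩ : ∃ j, k = j + 1 := ⟨k - 1, by omega⟩
      exact weightSum_pos hα j
    have ha : α k = p k * weightSum α (k + 1) := (div_mul_cancel₀ _ hS1.ne').symm
    have hsucc := weightSum_succ α k
    -- The left side is `p / (1 - p)`, and the bound holds for `p ≤ 1 / 2`.
    have hq : α k / weightSum α k ≤ p k + 2 * p k * p k := by
      rw [div_le_iff₀ hS]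
      have h3 : weightSum α k = (1 - p k) * weightSum α (k + 1) := by linarith
      rw [h3]
      have h4 : p k ≤ (p k + 2 * p k * p k) * (1 - p k) := by nlinarith [mul_pos hp0 hp0]
      calc α k = p k * weightSum α (k + 1) := ha
        _ ≤ ((p k + 2 * p k * p k) * (1 - p k)) * weightSum α (k + 1) :=
            mul_le_mul_of_nonneg_right h4 hS1.le
        _ = _ := by ring
    rw [one_mul, Real.norm_eq_abs, Real.norm_eq_abs, abs_of_nonneg (sub_nonneg.2 hl),
      abs_of_nonneg (by positivity)]
    linarith
  have h1 := (hlo.sum_range (fun k => (weightSum_ratio_mem hα k).1.le) hEt).tendsto_div_nhds_zero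
  have h2 : Tendsto (fun n => Real.log (weightSum α n) / E n) atTop (𝓝 1) := by
    have h3 := h1.add_const 1
    rw [zero_add] at h3
    refine h3.congr' ?_
    filter_upwards [hEt.eventually_gt_atTop 0] with n hn
    rw [Finset.sum_sub_distrib, sum_log_sub_log]
    change (_ - E n) / E n + 1 = _
    rw [sub_div, div_self hn.ne', sub_add_cancel]
  simpa using h2.inv₀ one_ne_zero

/-- The increments of `log s` are `-log (1 - p)` and tend to infinity while `p` stays bounded, so
`p` is negligible against them, also after summation. -/
lemma tendsto_sum_ratio_div_log_zero (hα : ∀ n, 0 < α n) (hs : Tendsto (weightSum α) atTop atTop)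
    (hp : Tendsto (fun k => α k / weightSum α (k + 1)) atTop (𝓝 1)) :
    Tendsto (fun n => (∑ k ∈ Finset.range n, α k / weightSum α (k + 1)) /
      Real.log (weightSum α n)) atTop (𝓝 0) := by
  set p : ℕ → ℝ := fun k => α k / weightSum α (k + 1) with hpdef
  set L : ℕ → ℝ := fun k => Real.log (weightSum α (k + 1)) - Real.log (weightSum α k) with hL
  have hlog : Tendsto (fun n => Real.log (weightSum α n)) atTop atTop :=
    Real.tendsto_log_atTop.comp hs
  have hLt : Tendsto L atTop atTop := by
    have h1 : Tendsto (fun k => 1 - p k) atTop (𝓝[≠] 0) := by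
      refine tendsto_nhdsWithin_iff.2 ⟨by simpa using hp.const_sub 1, ?_⟩
      filter_upwards [eventually_ge_atTop 1] with k hk
      obtain ⟨j, rfl⟩ : ∃ j, k = j + 1 := ⟨k - 1, by omega⟩
      have h2 := weightSum_pos hα j
      have h3 := weightSum_pos hα (j + 1)
      have h4 := weightSum_succ α (j + 1)
      have : p (j + 1) < 1 := (div_lt_one h3).2 (by linarith)
      exact (sub_pos.2 this).ne'
    have h2 := tendsto_neg_atBot_atTop.comp (Real.tendsto_log_nhdsNE_zero.comp h1)
    refine h2.congr' ?_
    filter_upwards [eventually_ge_atTop 1] with k hk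
    obtain ⟨j, rfl⟩ : ∃ j, k = j + 1 := ⟨k - 1, by omega⟩
    have h2 := weightSum_pos hα j
    have h3 := weightSum_pos hα (j + 1)
    have e : 1 - p (j + 1) = weightSum α (j + 1) / weightSum α (j + 1 + 1) := by
      rw [eq_div_iff h3.ne', sub_mul, one_mul, hpdef]
      simp only
      rw [div_mul_cancel₀ _ h3.ne', weightSum_succ α (j + 1)]
      ring
    simp only [Function.comp_apply, hL]
    rw [e, Real.log_div h2.ne' h3.ne']
    ring
  -- Only the initial increment `L 0 = log (α 0)` can be negative, so the absolute values change the
  -- sums by a constant.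
  have hlo : p =o[atTop] fun k => |L k| := by
    have h1 : p =O[atTop] fun _ => (1 : ℝ) := hp.isBigO_one ℝ
    refine h1.trans_isLittleO ?_
    rw [Asymptotics.isLittleO_const_left]
    right
    simpa [Function.comp_def] using tendsto_abs_atTop_atTop.comp hLt
  have hsum : ∀ n, ∑ k ∈ Finset.range (n + 1), |L k| =
      Real.log (weightSum α (n + 1)) + (|L 0| - L 0) := by
    intro n
    rw [← sum_log_sub_log]
    induction n with
    | zero => simp [hL]
    | succ n ih =>
      rw [Finset.sum_range_succ, ih, Finset.sum_range_succ _ (n + 1)]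
      have : 0 ≤ L (n + 1) := (weightSum_ratio_mem hα (n + 1)).1.le.trans
        (ratio_le_log_sub_log hα (by omega))
      rw [abs_of_nonneg this]
      simp only [hL]
      ring
  have hsum' : ∀ᶠ n in atTop, ∑ k ∈ Finset.range n, |L k| =
      Real.log (weightSum α n) + (|L 0| - L 0) := by
    filter_upwards [eventually_ge_atTop 1] with n hn
    obtain ⟨m, rfl⟩ : ∃ m, n = m + 1 := ⟨n - 1, by omega⟩
    exact hsum m
  have hA : Tendsto (fun n => ∑ k ∈ Finset.range n, |L k|) atTop atTop :=
    (tendsto_atTop_add_const_right _ _ hlog).congr' (hsum'.mono fun n hn => hn.symm)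
  have h1 := (hlo.sum_range (fun k => abs_nonneg _) hA).tendsto_div_nhds_zero
  have h2 : Tendsto (fun n => (∑ k ∈ Finset.range n, |L k|) / Real.log (weightSum α n)) atTop
      (𝓝 (1 + 0)) := by
    refine (tendsto_const_nhds.add
      ((tendsto_const_nhds (x := |L 0| - L 0)).div_atTop hlog)).congr' ?_
    filter_upwards [hsum', hlog.eventually_gt_atTop 0] with n h1 h2
    rw [h1, add_div, div_self h2.ne']
  have h3 := h1.mul h2
  rw [zero_mul] at h3
  refine h3.congr' ?_
  filter_upwards [hA.eventually_gt_atTop 0] with n hn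
  exact div_mul_div_cancel₀ hn.ne'

end Asymptotics

/-! ### Moments and limit theorems for the record counts of an `F^α`-scheme -/

lemma integral_recordIndicator {Ω : Type*} [MeasurableSpace Ω] {P : Measure Ω} {Y : ℕ → Ω → ℝ}
    (hY : ∀ n, Measurable (Y n)) (k : ℕ) :
    ∫ ω, recordIndicator (fun j => Y j ω) k ∂P = recordProb Y P k := by
  have hset : MeasurableSet {ω | recordIndicator (fun j => Y j ω) k = 1} :=
    measurable_recordIndicator_comp hY k (measurableSet_singleton 1)
  have e : (fun ω => recordIndicator (fun j => Y j ω) k) =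
      {ω | recordIndicator (fun j => Y j ω) k = 1}.indicator fun _ => (1 : ℝ) := by
    ext ω
    rcases recordIndicator_eq_zero_or_one (fun j => Y j ω) k with h | h
    · simp [h]
    · simp [h]
  rw [e, integral_indicator_const _ hset]
  simp [recordProb]

section Scheme

variable {Ω : Type*} [MeasurableSpace Ω] {P : Measure Ω} [IsProbabilityMeasure P]
  {F : ℝ → ℝ} {α : ℕ → ℝ} {Y : ℕ → Ω → ℝ}

lemma integrable_recordIndicator (hY : ∀ n, Measurable (Y n)) (k : ℕ) :
    Integrable (fun ω => recordIndicator (fun j => Y j ω) k) P :=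
  Integrable.of_bound (measurable_recordIndicator_comp hY k).aestronglyMeasurable 1
    (ae_of_all _ fun ω => by
      rw [Real.norm_eq_abs, abs_of_nonneg (recordIndicator_nonneg _ _)]
      exact recordIndicator_le_one _ _)

lemma integral_sq_recordIndicator_sub (hY : ∀ n, Measurable (Y n)) (k : ℕ) :
    ∫ ω, (recordIndicator (fun j => Y j ω) k - recordProb Y P k) ^ 2 ∂P =
      recordProb Y P k * (1 - recordProb Y P k) := by
  have e : ∀ ω, (recordIndicator (fun j => Y j ω) k - recordProb Y P k) ^ 2 =
      (1 - 2 * recordProb Y P k) * recordIndicator (fun j => Y j ω) k + recordProb Y P k ^ 2 := by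
    intro ω
    rcases recordIndicator_eq_zero_or_one (fun j => Y j ω) k with h | h
    · rw [h]; ring
    · rw [h]; ring
  simp_rw [e]
  rw [integral_add ((integrable_recordIndicator hY k).const_mul _) (integrable_const _),
    integral_const_mul, integral_recordIndicator hY]
  simp
  ring

lemma recordMean_eq_sum (hY : ∀ n, Measurable (Y n)) (n : ℕ) :
    recordMean Y P n = ∑ k ∈ Finset.range n, recordProb Y P k := by
  simp only [recordMean, recordCount]
  rw [integral_finsetSum _ fun k _ => integrable_recordIndicator hY k]
  exact Finset.sum_congr rfl fun k _ => integral_recordIndicator hY k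

lemma abs_recordIndicator_sub_le (k : ℕ) (ω : Ω) :
    |recordIndicator (fun j => Y j ω) k - recordProb Y P k| ≤ 1 := by
  have h1 := recordIndicator_nonneg (fun j => Y j ω) k
  have h2 := recordIndicator_le_one (fun j => Y j ω) k
  have h3 : 0 ≤ recordProb Y P k := measureReal_nonneg
  have h4 : recordProb Y P k ≤ 1 := measureReal_le_one
  rw [abs_le]
  constructor <;> linarith

lemma memLp_recordIndicator_sub (hY : ∀ n, Measurable (Y n)) (k : ℕ) :
    MemLp (fun ω => recordIndicator (fun j => Y j ω) k - recordProb Y P k) 2 P :=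
  MemLp.of_bound ((measurable_recordIndicator_comp hY k).sub_const _).aestronglyMeasurable 1
    (ae_of_all _ fun ω => abs_recordIndicator_sub_le k ω)

lemma integral_recordIndicator_sub (hY : ∀ n, Measurable (Y n)) (k : ℕ) :
    ∫ ω, (recordIndicator (fun j => Y j ω) k - recordProb Y P k) ∂P = 0 := by
  rw [integral_sub (integrable_recordIndicator hY k) (integrable_const _),
    integral_recordIndicator hY]
  simp

lemma recordCount_sub_recordMean (hY : ∀ n, Measurable (Y n)) (n : ℕ) (x : ℕ → ℝ) :
    recordCount x n - recordMean Y P n =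
      ∑ k ∈ Finset.range n, (recordIndicator x k - recordProb Y P k) := by
  rw [recordMean_eq_sum hY, recordCount, Finset.sum_sub_distrib]

lemma iIndepFun_recordIndicator_sub (hα : ∀ n, 0 < α n) (hF : IsContinuousDF F)
    (h : IsFAlphaScheme F α Y P) :
    iIndepFun (fun k ω => recordIndicator (fun j => Y j ω) k - recordProb Y P k) P :=
  (iIndepFun_recordIndicator hα hF h).comp (fun k x => x - recordProb Y P k) fun _ =>
    measurable_id.sub_const _

lemma recordVar_eq_sum (hα : ∀ n, 0 < α n) (hF : IsContinuousDF F) (h : IsFAlphaScheme F α Y P)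
    (n : ℕ) : recordVar Y P n =
      ∑ k ∈ Finset.range n, recordProb Y P k * (1 - recordProb Y P k) := by
  have hY := h.measurable
  have hm : Measurable fun ω => recordCount (fun j => Y j ω) n :=
    (measurable_recordCount n).comp (measurable_pi_lambda _ hY)
  rw [recordVar, variance_eq_integral hm.aemeasurable]
  have e : ∀ ω, recordCount (fun j => Y j ω) n - ∫ ω, recordCount (fun j => Y j ω) n ∂P =
      ∑ k ∈ Finset.range n, (recordIndicator (fun j => Y j ω) k - recordProb Y P k) := fun ω =>
    recordCount_sub_recordMean hY n _
  simp_rw [e]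
  rw [integral_sq_sum_of_iIndepFun (memLp_recordIndicator_sub hY)
    (iIndepFun_recordIndicator_sub hα hF h) (integral_recordIndicator_sub hY)]
  exact Finset.sum_congr rfl fun k _ => integral_sq_recordIndicator_sub hY k

lemma tendsto_recordMean (hα : ∀ n, 0 < α n) (hs : Tendsto (weightSum α) atTop atTop)
    (hF : IsContinuousDF F) (h : IsFAlphaScheme F α Y P) :
    Tendsto (recordMean Y P) atTop atTop := by
  refine (tendsto_sum_div_weightSum hα hs).congr fun n => ?_
  rw [recordMean_eq_sum h.measurable]
  exact Finset.sum_congr rfl fun k _ => (recordProb_eq hα hF h k).symm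

lemma ae_tendsto_recordCount_sub_div (hα : ∀ n, 0 < α n) (hs : Tendsto (weightSum α) atTop atTop)
    (hF : IsContinuousDF F) (h : IsFAlphaScheme F α Y P) :
    ∀ᵐ ω ∂P, Tendsto (fun n => (recordCount (fun j => Y j ω) n - recordMean Y P n) /
      recordMean Y P n) atTop (𝓝 0) := by
  have hY := h.measurable
  have hE := tendsto_recordMean hα hs hF h
  simp_rw [recordCount_sub_recordMean hY, recordMean_eq_sum hY]
  refine ae_tendsto_sum_sub_div (measurable_recordIndicator_comp hY)
    (fun n ω => ⟨recordIndicator_nonneg _ _, recordIndicator_le_one _ _⟩)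
    (iIndepFun_recordIndicator hα hF h) (integral_recordIndicator hY) ?_ ?_
  · rw [recordProb_eq hα hF h]
    exact (weightSum_ratio_mem hα 0).1
  · exact hE.congr fun n => recordMean_eq_sum hY n

lemma ae_exists_tendsto_recordCount_sub (hα : ∀ n, 0 < α n) (hF : IsContinuousDF F)
    (h : IsFAlphaScheme F α Y P) (hV : ∃ v, Tendsto (recordVar Y P) atTop (𝓝 v)) :
    ∀ᵐ ω ∂P, ∃ c, Tendsto (fun n => recordCount (fun j => Y j ω) n - recordMean Y P n) atTop
      (𝓝 c) := by
  have hY := h.measurable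
  obtain ⟨v, hv⟩ := hV
  obtain ⟨R, hR⟩ := hv.bddAbove_range
  simp_rw [recordCount_sub_recordMean hY]
  refine ae_exists_tendsto_sum_of_iIndepFun (R := R)
    (fun n => (measurable_recordIndicator_comp hY n).sub_const _) (memLp_recordIndicator_sub hY)
    (iIndepFun_recordIndicator_sub hα hF h) (integral_recordIndicator_sub hY) fun n => ?_
  simp_rw [integral_sq_recordIndicator_sub hY]
  rw [← recordVar_eq_sum hα hF h]
  exact hR ⟨n, rfl⟩

lemma tendstoInDistribution_recordCount (hα : ∀ n, 0 < α n) (hF : IsContinuousDF F)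
    (h : IsFAlphaScheme F α Y P) (hV : Tendsto (recordVar Y P) atTop atTop) :
    TendstoInDistribution (fun n ω => (recordCount (fun j => Y j ω) n - recordMean Y P n) /
      √(recordVar Y P n)) atTop id (fun _ => P) (gaussianReal 0 1) := by
  have hY := h.measurable
  simp_rw [recordCount_sub_recordMean hY]
  refine tendstoInDistribution_sum_div_sqrt
    (fun n => (measurable_recordIndicator_comp hY n).sub_const _) abs_recordIndicator_sub_le
    (iIndepFun_recordIndicator_sub hα hF h) (integral_recordIndicator_sub hY) (fun n => ?_) hV
  simp_rw [integral_sq_recordIndicator_sub hY]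
  exact recordVar_eq_sum hα hF h n

end Scheme

/-! ### Transfer of limit theorems to threshold schemes -/

lemma tendstoInDistribution_of_map_eq {A B C : Type*} [MeasurableSpace A] [MeasurableSpace B]
    [MeasurableSpace C] {μ : Measure A} [IsProbabilityMeasure μ] {ν : Measure B}
    [IsProbabilityMeasure ν] {ρ : Measure ℝ} [IsProbabilityMeasure ρ] {f : A → C} {g : B → C}
    (hf : Measurable f) (hg : Measurable g) (h : μ.map f = ν.map g) {T : ℕ → C → ℝ}
    (hT : ∀ n, Measurable (T n))
    (hlim : TendstoInDistribution (fun n a => T n (f a)) atTop id (fun _ => μ) ρ) :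
    TendstoInDistribution (fun n b => T n (g b)) atTop id (fun _ => ν) ρ where
  forall_aemeasurable n := ((hT n).comp hg).aemeasurable
  aemeasurable_limit := aemeasurable_id
  tendsto := by
    refine hlim.tendsto.congr fun n => ?_
    apply Subtype.ext
    change μ.map (T n ∘ f) = ν.map (T n ∘ g)
    rw [← Measure.map_map (hT n) hf, ← Measure.map_map (hT n) hg, h]

/-- For each outcome the normalized counts eventually differ by a constant over `r n`, which
vanishes almost surely, hence in measure; Slutsky's theorem applies. -/
lemma tendstoInDistribution_of_countsTailEquiv {A : Type*} [MeasurableSpace A] {μ : Measure A}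
    [IsProbabilityMeasure μ] {ρ : Measure ℝ} [IsProbabilityMeasure ρ] {f g : A → ℕ → ℝ}
    (hg : Measurable g) (h : ∀ᵐ a ∂μ, CountsTailEquiv (f a) (g a)) {e r : ℕ → ℝ}
    (hr : Tendsto r atTop atTop)
    (hlim : TendstoInDistribution (fun n a => (recordCount (f a) n - e n) / r n) atTop id
      (fun _ => μ) ρ) :
    TendstoInDistribution (fun n a => (recordCount (g a) n - e n) / r n) atTop id
      (fun _ => μ) ρ := by
  have hgm : ∀ n, AEMeasurable (fun a => (recordCount (g a) n - e n) / r n) μ := fun n =>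
    ((((measurable_recordCount n).comp hg).sub_const _).div_const _).aemeasurable
  refine tendstoInDistribution_of_tendstoInMeasure_sub _ _ hlim ?_ hgm
  refine tendstoInMeasure_of_tendsto_ae ?_ ?_
  · exact fun n => ((hgm n).sub (hlim.forall_aemeasurable n)).aestronglyMeasurable
  · filter_upwards [h] with a ⟨c, hc⟩
    refine ((tendsto_const_nhds (x := -c)).div_atTop hr).congr' ?_
    filter_upwards [hc] with n hn
    simp only [Pi.sub_apply]
    rw [hn, ← sub_div]
    ring

section Threshold

variable {Ω Ω' : Type*} [MeasurableSpace Ω] [MeasurableSpace Ω'] {P : Measure Ω}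
  [IsProbabilityMeasure P] {P' : Measure Ω'} [IsProbabilityMeasure P'] {F : ℝ → ℝ}
  {α ℓ : ℕ → ℝ} {X : ℕ → Ω → ℝ} {Y : ℕ → Ω' → ℝ}

/-- Almost sure properties of the record counts that are insensitive to an eventually constant shift
pass from the `F^α`-scheme to the threshold scheme. -/
theorem IsThresholdScheme.ae_of_ae (hY : IsFAlphaScheme F α Y P')
    (hX : IsThresholdScheme F α ℓ X P Y P') {φ : (ℕ → ℝ) → Prop}
    (hφ : MeasurableSet {x : ℕ → ℝ | φ (recordCount x)})
    (hshift : ∀ (a b : ℕ → ℝ) (c : ℝ), (∀ᶠ n in atTop, a n = b n + c) → φ a → φ b)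
    (h : ∀ᵐ ω ∂P', φ (recordCount fun j => Y j ω)) :
    ∀ᵐ ω ∂P, φ (recordCount fun j => X j ω) := by
  obtain ⟨hXZ, hYW, Q, hQ, hQ1, hQ2, hQe⟩ := hX.exists_coupling hY
  have htail : ∀ x y : ℕ → ℝ, CountsTailEquiv x y → φ (recordCount x) → φ (recordCount y) :=
    fun x y ⟨c, hc⟩ => hshift _ _ c hc
  have hZ' : Measurable fun ω n => X n ω ⊔ ℓ n :=
    measurable_pi_lambda _ fun n => (hX.measurable n).sup_const _
  have hW' : Measurable fun ω n => Y n ω ⊔ ℓ n :=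
    measurable_pi_lambda _ fun n => (hY.measurable n).sup_const _
  have hu' : Measurable fun (z : ℕ → ℝ × ℝ) n => (z n).1 :=
    measurable_pi_lambda _ fun n => measurable_fst.comp (measurable_pi_apply n)
  have hw' : Measurable fun (z : ℕ → ℝ × ℝ) n => (z n).2 :=
    measurable_pi_lambda _ fun n => measurable_snd.comp (measurable_pi_apply n)
  -- The property travels from `Y` to its truncation, through the second and first marginals of the
  -- coupling, to the truncation of `X` and finally to `X`.
  have h1 : ∀ᵐ ω ∂P', φ (recordCount fun n => Y n ω ⊔ ℓ n) := by
    filter_upwards [h, hYW] with ω h1 h2 using htail _ _ h2.symm h1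
  have h2 := (ae_iff_of_map_eq hw' hW' hQ2 hφ).2 h1
  have h3 : ∀ᵐ z ∂Q, φ (recordCount fun n => (z n).1) := by
    filter_upwards [h2, hQe] with ω h1 h2 using htail _ _ h2.symm h1
  have h4 := (ae_iff_of_map_eq hu' hZ' hQ1 hφ).1 h3
  filter_upwards [h4, hXZ] with ω h1 h2 using htail _ _ h2 h1

/-- Limits in distribution of the normalized record counts pass from the `F^α`-scheme to the
threshold scheme. -/
theorem IsThresholdScheme.tendstoInDistribution (hY : IsFAlphaScheme F α Y P')
    (hX : IsThresholdScheme F α ℓ X P Y P') {ρ : Measure ℝ} [IsProbabilityMeasure ρ]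
    {e r : ℕ → ℝ} (hr : Tendsto r atTop atTop)
    (h : TendstoInDistribution (fun n ω => (recordCount (fun j => Y j ω) n - e n) / r n) atTop id
      (fun _ => P') ρ) :
    TendstoInDistribution (fun n ω => (recordCount (fun j => X j ω) n - e n) / r n) atTop id
      (fun _ => P) ρ := by
  obtain ⟨hXZ, hYW, Q, hQ, hQ1, hQ2, hQe⟩ := hX.exists_coupling hY
  have hZ' : Measurable fun ω n => X n ω ⊔ ℓ n :=
    measurable_pi_lambda _ fun n => (hX.measurable n).sup_const _
  have hW' : Measurable fun ω n => Y n ω ⊔ ℓ n :=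
    measurable_pi_lambda _ fun n => (hY.measurable n).sup_const _
  have hu' : Measurable fun (z : ℕ → ℝ × ℝ) n => (z n).1 :=
    measurable_pi_lambda _ fun n => measurable_fst.comp (measurable_pi_apply n)
  have hw' : Measurable fun (z : ℕ → ℝ × ℝ) n => (z n).2 :=
    measurable_pi_lambda _ fun n => measurable_snd.comp (measurable_pi_apply n)
  have hT : ∀ n, Measurable fun x : ℕ → ℝ => (recordCount x n - e n) / r n := fun n =>
    ((measurable_recordCount n).sub_const _).div_const _
  have h1 := tendstoInDistribution_of_countsTailEquiv hW' (hYW.mono fun _ h => h.symm) hr h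
  have h2 := tendstoInDistribution_of_map_eq hW' hw' hQ2.symm hT h1
  have h3 := tendstoInDistribution_of_countsTailEquiv hu' (hQe.mono fun _ h => h.symm) hr h2
  have h4 := tendstoInDistribution_of_map_eq hu' hZ' hQ1 hT h3
  exact tendstoInDistribution_of_countsTailEquiv (measurable_pi_lambda _ hX.measurable) hXZ hr h4

/-- The centered record counts of a threshold scheme are of smaller order than their means. -/
theorem IsThresholdScheme.ae_tendsto_sub_div (hY : IsFAlphaScheme F α Y P')
    (hX : IsThresholdScheme F α ℓ X P Y P') :
    ∀ᵐ ω ∂P, Tendsto (fun n => (recordCount (fun j => X j ω) n - recordMean Y P' n) /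
      recordMean Y P' n) atTop (𝓝 0) := by
  have hE := tendsto_recordMean hX.alpha_pos hX.weightSum_tendsto hX.continuousDF hY
  refine hX.ae_of_ae hY (φ := fun a => Tendsto (fun n => (a n - recordMean Y P' n) /
    recordMean Y P' n) atTop (𝓝 0)) ?_ (fun a b c hab ha => ?_)
    (ae_tendsto_recordCount_sub_div hX.alpha_pos hX.weightSum_tendsto hX.continuousDF hY)
  · exact measurableSet_tendsto _ fun n => ((measurable_recordCount n).sub_const _).div_const _
  · have h1 := ha.sub ((tendsto_const_nhds (x := c)).div_atTop hE)
    rw [sub_zero] at h1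
    refine h1.congr' ?_
    filter_upwards [hab] with n hn
    rw [hn, ← sub_div]
    congr 1
    ring

theorem IsThresholdScheme.ae_exists_tendsto_sub (hY : IsFAlphaScheme F α Y P')
    (hX : IsThresholdScheme F α ℓ X P Y P') (hV : ∃ v, Tendsto (recordVar Y P') atTop (𝓝 v)) :
    ∀ᵐ ω ∂P, ∃ c, Tendsto (fun n => recordCount (fun j => X j ω) n - recordMean Y P' n) atTop
      (𝓝 c) := by
  refine hX.ae_of_ae hY (φ := fun a => ∃ c, Tendsto (fun n => a n - recordMean Y P' n) atTop
    (𝓝 c)) ?_ (fun a b c hab => ?_)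
    (ae_exists_tendsto_recordCount_sub hX.alpha_pos hX.continuousDF hY hV)
  · exact measurableSet_exists_tendsto fun n => (measurable_recordCount n).sub_const _
  · rintro ⟨d, hd⟩
    refine ⟨d - c, (hd.sub_const c).congr' ?_⟩
    filter_upwards [hab] with n hn
    rw [hn]
    ring

end Threshold

end RecordScheme

/-! ### The limit theorems for the threshold scheme -/

theorem corollary1 {Ω Ω' : Type*} [MeasurableSpace Ω] [MeasurableSpace Ω']
    (P : Measure Ω) [IsProbabilityMeasure P] (P' : Measure Ω') [IsProbabilityMeasure P']
    (F : ℝ → ℝ) (α ℓ : ℕ → ℝ) (X : ℕ → Ω → ℝ) (Y : ℕ → Ω' → ℝ)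
    (hY : RecordScheme.IsFAlphaScheme F α Y P')
    (hX : RecordScheme.IsThresholdScheme F α ℓ X P Y P')
    (N : ℕ → Ω → ℝ) (hN : ∀ n ω, N n ω = RecordScheme.recordCount (fun j => X j ω) n)
    (s p E V : ℕ → ℝ) (hs : s = RecordScheme.weightSum α)
    (hp : p = RecordScheme.recordProb Y P')
    (hE : E = RecordScheme.recordMean Y P') (hV : V = RecordScheme.recordVar Y P') :
    -- the centering and scaling sequences, in terms of the exponents
    ((∀ k, p k = α k / s (k + 1)) ∧
      (∀ n, E n = ∑ k ∈ Finset.range n, p k) ∧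
      (∀ n, V n = ∑ k ∈ Finset.range n, p k * (1 - p k))) ∧
    -- divergence of the record count
    (∀ᵐ ω ∂P, Tendsto (fun n => N n ω) atTop atTop) ∧
    -- the strong law of large numbers
    (∀ᵐ ω ∂P, Tendsto (fun n => N n ω / E n) atTop (𝓝 1)) ∧
    -- comparison with the logarithm of the sum of the exponents
    ((∀ᵐ ω ∂P, Tendsto (fun n => (N n ω - E n) / Real.log (s n)) atTop (𝓝 0)) ∧
      (Tendsto p atTop (𝓝 0) →
        ∀ᵐ ω ∂P, Tendsto (fun n => N n ω / Real.log (s n)) atTop (𝓝 1)) ∧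
      (Tendsto p atTop (𝓝 1) →
        ∀ᵐ ω ∂P, Tendsto (fun n => N n ω / Real.log (s n)) atTop (𝓝 0))) ∧
    -- almost sure convergence or asymptotic normality
    (((∃ v, Tendsto V atTop (𝓝 v)) →
        ∃ Z : Ω → ℝ, Measurable Z ∧
          ∀ᵐ ω ∂P, Tendsto (fun n => N n ω - E n) atTop (𝓝 (Z ω))) ∧
      (Tendsto V atTop atTop →
        TendstoInDistribution (fun n ω => (N n ω - E n) / √(V n)) atTop id
          (fun _ => P) (gaussianReal 0 1))) := by
  have hα := hX.alpha_pos
  have hF := hX.continuousDF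
  have hst := hX.weightSum_tendsto
  have hpk : ∀ k, p k = α k / s (k + 1) := fun k => by
    rw [hp, hs]; exact RecordScheme.recordProb_eq hα hF hY k
  have hEn : ∀ n, E n = ∑ k ∈ Finset.range n, p k := fun n => by
    rw [hE, hp]; exact RecordScheme.recordMean_eq_sum hY.measurable n
  have hVn : ∀ n, V n = ∑ k ∈ Finset.range n, p k * (1 - p k) := fun n => by
    rw [hV, hp]; exact RecordScheme.recordVar_eq_sum hα hF hY n
  have hEt : Tendsto E atTop atTop := by
    rw [hE]; exact RecordScheme.tendsto_recordMean hα hst hF hY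
  have hEsum : ∀ n, E n = ∑ k ∈ Finset.range n, α k / RecordScheme.weightSum α (k + 1) :=
    fun n => by rw [hEn n]; exact Finset.sum_congr rfl fun k _ => by rw [hpk, hs]
  have hpfun : p = fun k => α k / RecordScheme.weightSum α (k + 1) := by
    ext k; rw [hpk, hs]
  have hlog : Tendsto (fun n => Real.log (s n)) atTop atTop := by
    rw [hs]; exact Real.tendsto_log_atTop.comp hst
  have h0 : ∀ᵐ ω ∂P, Tendsto (fun n => (N n ω - E n) / E n) atTop (𝓝 0) := by
    simp_rw [hN, hE]
    exact hX.ae_tendsto_sub_div hY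
  have h1 : ∀ᵐ ω ∂P, Tendsto (fun n => N n ω / E n) atTop (𝓝 1) := by
    filter_upwards [h0] with ω hω
    have := hω.add_const 1
    rw [zero_add] at this
    refine this.congr' ?_
    filter_upwards [hEt.eventually_gt_atTop 0] with n hn
    rw [sub_div, div_self hn.ne', sub_add_cancel]
  have h2 : ∀ᵐ ω ∂P, Tendsto (fun n => (N n ω - E n) / Real.log (s n)) atTop (𝓝 0) := by
    filter_upwards [h0] with ω hω
    -- Eventually `E n ≤ 2 * log (s n)`, whatever the behaviour of `p`, so changing the
    -- normalization costs at most a factor two.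
    have hb : ∀ᶠ n in atTop, ‖(N n ω - E n) / Real.log (s n)‖ ≤ 2 * |(N n ω - E n) / E n| := by
      filter_upwards [hEt.eventually_gt_atTop 0, hlog.eventually_gt_atTop 0,
        RecordScheme.eventually_sum_ratio_le_two_mul_log hα hst] with n hn1 hn2 hn3
      rw [← hEsum, ← hs] at hn3
      rw [Real.norm_eq_abs, abs_div, abs_div, abs_of_pos hn1, abs_of_pos hn2, mul_div_assoc',
        div_le_div_iff₀ hn2 hn1]
      nlinarith [abs_nonneg (N n ω - E n)]
    refine squeeze_zero_norm' hb ?_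
    simpa using hω.abs.const_mul 2
  have h3 : ∀ c, Tendsto (fun n => E n / Real.log (s n)) atTop (𝓝 c) →
      ∀ᵐ ω ∂P, Tendsto (fun n => N n ω / Real.log (s n)) atTop (𝓝 c) := by
    intro c hc
    filter_upwards [h2] with ω hω
    have := hω.add hc
    rw [zero_add] at this
    refine this.congr fun n => ?_
    rw [← add_div, sub_add_cancel]
  refine ⟨⟨hpk, hEn, hVn⟩, ?_, h1, ⟨h2, fun hp0 => h3 1 ?_, fun hp1 => h3 0 ?_⟩, fun hv => ?_,
    fun hv => ?_⟩
  · filter_upwards [h1] with ω hω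
    refine (hω.pos_mul_atTop one_pos hEt).congr' ?_
    filter_upwards [hEt.eventually_gt_atTop 0] with n hn
    exact div_mul_cancel₀ _ hn.ne'
  · rw [hpfun] at hp0
    simp_rw [hEsum, hs]
    exact RecordScheme.tendsto_sum_ratio_div_log_one hα hst hp0
  · rw [hpfun] at hp1
    simp_rw [hEsum, hs]
    exact RecordScheme.tendsto_sum_ratio_div_log_zero hα hst hp1
  · rw [hV] at hv
    simp_rw [hN, hE]
    refine measurable_limit_of_tendsto_metrizable_ae (fun n => ?_) (hX.ae_exists_tendsto_sub hY hv)
    exact (((RecordScheme.measurable_recordCount n).comp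
      (measurable_pi_lambda _ hX.measurable)).sub_const _).aemeasurable
  · have hr : Tendsto (fun n => √(V n)) atTop atTop := Real.tendsto_sqrt_atTop.comp hv
    rw [hV] at hv hr
    simp_rw [hN, hE, hV]
    exact hX.tendstoInDistribution hY hr
      (RecordScheme.tendstoInDistribution_recordCount hα hF hY hv)
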